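/- **Theorem (contraction and cut on the BR polynomial).** A ribbon graph with flags $\mathcal{G}=\mathcal{G}(\mathcal{V},\mathcal{E},\mathfrak{f}^0)$ is a finite, not necessarily orientable, ribbon graph (vertex discs with edge ribbons, each edge attached along two segments of the vertex boundaries) together with finitely many flags, i.e. half-ribbons attached to a vertex along one segment, whose opposite segment is free and has two end points, the external points of the flag. Cutting an edge $e$ replaces it by two flags attached where its ends were; the result is $\mathcal{G}\vee e$. A spanning c-subgraph $A\Subset\mathcal{G}$ is obtained from $\mathcal{G}$ by keeping all vertices and all flags and cutting all edges outside a subset $\mathcal{E}_A\subseteq\mathcal{E}$. For such $A$ let $k(A)$ be its number of connected components, ${\rm r}(A)=|\mathcal{V}|-k(A)$, $n(A)=|\mathcal{E}_A|-{\rm r}(A)$, and let $f(A)$ be its number of flags. A boundary component of the ribbon graph which never passes through the free segment of a flag is a closed face; $F_{\rm int}(A)$ is the number of closed faces. The parts of the boundary running from an external point of a flag to the next external point are the open faces. The boundary graph $\partial A$ has the flags of $A$ as vertices and the open faces of $A$ as edges, and $C_\partial(A)$ is its number of connected components. Put $$\mathcal{R}_{\mathcal{G}}(x,y,z,s,t)=\sum_{A\Subset\mathcal{G}}(x-1)^{{\rm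 r}(\mathcal{G})-{\rm r}(A)}(y-1)^{n(A)}z^{k(A)-F_{\rm int}(A)+n(A)}s^{C_\partial(A)}t^{f(A)} .$$ Let $\mathcal{G}-e$ denote the removal of the ribbon $e$, keeping the vertex discs. A self-loop $e$ at a vertex $v$ divides the remaining half-ribbons at $v$ into two sides $P,Q$ (the two arcs of the boundary of $v$ between the ends of $e$). It is untwisted if $v\cup e$ is an annulus and twisted if $v\cup e$ is a Möbius band. It is trivial if no cycle of $\mathcal{G}$ is interlaced with it, i.e. no path avoiding $v$ leads from a half-edge in $P$ to a half-edge in $Q$ (in particular no other loop at $v$ has one end in each). The edge $e$ is a bridge if removing it disconnects a component of $\mathcal{G}$, and regular if it is neither a self-loop nor a bridge. The contraction $\mathcal{G}/e$ is defined as follows. If $e$ is not a self-loop, $e$ and its two end vertices are replaced by one vertex disc bounded by the boundary of their union, carrying all their remaining edges and flags in the same cyclic order. If $e$ is a trivial twisted self-loop, $\mathcal{G}/e=\mathcal{G}-e$. If $e$ is a trivial untwisted self-loop at $v$, then $e$ and $v$ are replaced by two vertex discs bounded by the two boundary circles of the annulus $v\cup e$, one carrying the half-ribbons of $P$ and the other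 those of $Q$; in particular, if one of the two sides is empty, $\mathcal{G}/e=(\mathcal{G}-e)\sqcup\{v_0\}$ with a new isolated vertex $v_0$. Then, for every ribbon graph with flags $\mathcal{G}$ and every edge $e$ of $\mathcal{G}$: * if $e$ is regular, $\mathcal{R}_{\mathcal{G}}=\mathcal{R}_{\mathcal{G}\vee e}+\mathcal{R}_{\mathcal{G}/e}$; * if $e$ is a bridge, $\mathcal{R}_{\mathcal{G}}=(x-1)\,\mathcal{R}_{\mathcal{G}\vee e}+\mathcal{R}_{\mathcal{G}/e}$; * if $e$ is a trivial twisted self-loop, $\mathcal{R}_{\mathcal{G}}=\mathcal{R}_{\mathcal{G}\vee e}+(y-1)z\,\mathcal{R}_{\mathcal{G}/e}$; * if $e$ is a trivial untwisted self-loop, $\mathcal{R}_{\mathcal{G}}=\mathcal{R}_{\mathcal{G}\vee e}+(y-1)\,\mathcal{R}_{\mathcal{G}/e}$; in particular, if one side of $e$ is empty, $\mathcal{R}_{\mathcal{G}}=\mathcal{R}_{\mathcal{G}\vee e}+(y-1)\,\mathcal{R}_{(\mathcal{G}-e)\sqcup\{v_0\}}$. -/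

import Mathlib

/-- A (finite) ribbon graph with flags, not necessarily orientable, presented combinatorially.

`H` is the set of half-ribbons (half-edges). Each `h : H` is glued to the boundary circle of a
vertex disc along a segment whose two end points are the *crosses* `(h, false)` and `(h, true)`.

* `pair h` is the other half of the ribbon edge of `h`; the fixed points of `pair` are the flags.
  The labels of the crosses are chosen such that the two strands (free sides) of the ribbon edge
  `{h, pair h}` join `(h, b)` to `(pair h, b)`; whether a ribbon is twisted is recorded by the way
  in which the labels follow each other around the vertices.
* `arc` joins every cross to the next cross along the boundary circle of its vertex, on the side
  which does not belong to the segment of its own half-ribbon. Thus each vertex circle is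
  made of segments `(h, false) — (h, true)` and of arcs, alternately.
* `isolated` is the number of vertex discs to which no half-ribbon is glued. -/
structure RibbonGraph (H : Type*) where
  pair : H → H
  pair_pair : ∀ h, pair (pair h) = h
  arc : H × Bool → H × Bool
  arc_arc : ∀ x, arc (arc x) = x
  arc_ne : ∀ x, arc x ≠ x
  isolated : ℕ

namespace RibbonGraph

variable {H : Type*}

/-- The cross at the other end of the segment of the same half-ribbon. -/
def flip (x : H × Bool) : H × Bool := (x.1, !x.2)

/-- The cross at the other end of the strand starting at `x` (`x` itself, if `x` is on a flag). -/
def strand (G : RibbonGraph H) (x : H × Bool) : H × Bool := (G.pair x.1, x.2)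

/-- `h` is a flag. -/
def IsFlag (G : RibbonGraph H) (h : H) : Prop := G.pair h = h

/-! ### Vertices, edges, connected components -/

/-- Vertex discs: the circles made of arcs and segments, and the isolated discs. -/
def Vertex (G : RibbonGraph H) : Type _ :=
  Quot (fun x y : H × Bool => y = G.arc x ∨ y = flip x) ⊕ Fin G.isolated

/-- The vertex to which the half-ribbon `h` is attached. -/
def vert (G : RibbonGraph H) (h : H) : G.Vertex := Sum.inl (Quot.mk _ (h, false))

/-- Connected components of the underlying graph. -/
def Component (G : RibbonGraph H) : Type _ :=
  Quot (fun u v : G.Vertex => ∃ h, u = G.vert h ∧ v = G.vert (G.pair h))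

/-- Edges: the unordered pairs of distinct paired half-ribbons. -/
def edges [Fintype H] [DecidableEq H] (G : RibbonGraph H) : Finset (Sym2 H) :=
  (Finset.univ.filter fun h => G.pair h ≠ h).image fun h => s(h, G.pair h)

/-- Number of vertices. -/
noncomputable def numVertices (G : RibbonGraph H) : ℕ := Nat.card G.Vertex

/-- `k(G)`. -/
noncomputable def numComponents (G : RibbonGraph H) : ℕ := Nat.card G.Component

/-- The number of flags, `f(G)`. -/
noncomputable def numFlags (G : RibbonGraph H) : ℕ := Nat.card {h : H // G.IsFlag h}

/-- The rank `r(G) = |V| - k(G)` (always `k(G) ≤ |V|`). -/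
noncomputable def rank (G : RibbonGraph H) : ℕ := G.numVertices - G.numComponents

/-- The nullity `n(G) = |E| + k(G) - |V|` (always `|V| ≤ |E| + k(G)`). -/
noncomputable def nullity [Fintype H] [DecidableEq H] (G : RibbonGraph H) : ℕ :=
  G.edges.card + G.numComponents - G.numVertices

/-! ### Faces and boundary graph -/

/-- The boundary curves which run along the arcs of the vertices and the strands of the edges;
a curve reaching a flag ends at an external point of that flag. The boundaries of
the isolated vertices are not included here. -/
def Face (G : RibbonGraph H) : Type _ :=
  Quot (fun x y : H × Bool => y = G.arc x ∨ y = G.strand x)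

/-- The face passing through the cross `x`. -/
def face (G : RibbonGraph H) (x : H × Bool) : G.Face := Quot.mk _ x

/-- Open (external) faces: those which end at external points of flags. -/
def Face.IsOpen {G : RibbonGraph H} (f : G.Face) : Prop :=
  ∃ x : H × Bool, G.IsFlag x.1 ∧ G.face x = f

/-- The number of closed (internal) faces; the boundary of each isolated vertex is one of them. -/
noncomputable def numClosedFaces (G : RibbonGraph H) : ℕ :=
  Nat.card {f : G.Face // ¬ f.IsOpen} + G.isolated

/-- Connected components of the boundary graph: its vertices are the flags and its edges are the
open faces, an open face being incident to the flags at whose external points it ends. -/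
def BoundaryComponent (G : RibbonGraph H) : Type _ :=
  Quot (fun g h : {h : H // G.IsFlag h} =>
    ∃ f : G.Face, (∃ b, G.face (g.1, b) = f) ∧ ∃ c, G.face (h.1, c) = f)

/-- The number `C_∂(G)` of connected components of the boundary graph. -/
noncomputable def numBoundaryComponents (G : RibbonGraph H) : ℕ := Nat.card G.BoundaryComponent

/-! ### Spanning c-subgraphs and the polynomial -/

/-- The spanning c-subgraph with edge set `A`: all vertices and all flags are kept and every edge
not in `A` is cut into two flags. -/
def sub [DecidableEq H] (G : RibbonGraph H) (A : Finset (Sym2 H)) : RibbonGraph H where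
  pair h := if s(h, G.pair h) ∈ A then G.pair h else h
  pair_pair h := by
    by_cases hA : s(h, G.pair h) ∈ A
    · have hB : s(G.pair h, h) ∈ A := by rwa [Sym2.eq_swap]
      simp [hA, hB, G.pair_pair]
    · simp [hA]
  arc := G.arc
  arc_arc := G.arc_arc
  arc_ne := G.arc_ne
  isolated := G.isolated

open LaurentPolynomial in
/-- The polynomial `ℛ_G(x, y, z, s, t)`, as a Laurent polynomial in `z` over `ℤ[x, y, s, t]`, with
`x, y, s, t` the variables number `0, 1, 2, 3`. -/
noncomputable def brPoly [Fintype H] [DecidableEq H] (G : RibbonGraph H) :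
    LaurentPolynomial (MvPolynomial (Fin 4) ℤ) :=
  ∑ A ∈ G.edges.powerset,
    C ((MvPolynomial.X 0 - 1) ^ (G.rank - (G.sub A).rank)
        * (MvPolynomial.X 1 - 1) ^ (G.sub A).nullity)
      * T (((G.sub A).numComponents : ℤ) - (G.sub A).numClosedFaces + (G.sub A).nullity)
      * C (MvPolynomial.X 2 ^ (G.sub A).numBoundaryComponents
        * MvPolynomial.X 3 ^ (G.sub A).numFlags)

/-! ### Operations on the edge `e = {h, pair h}` -/

/-- The half-ribbon `x` is one of the two halves of the edge of `h`. -/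
def OnEdge (G : RibbonGraph H) (h x : H) : Prop := x = h ∨ x = G.pair h

/-- The half-ribbons other than the two halves of the edge of `h`. -/
abbrev Rest (G : RibbonGraph H) (h : H) : Type _ := {x : H // x ≠ h ∧ x ≠ G.pair h}

/-- The cut graph `G ∨ e`: the edge `e` is replaced by two flags. -/
def cut [DecidableEq H] (G : RibbonGraph H) (h : H) : RibbonGraph H where
  pair x := if x = h ∨ x = G.pair h then x else G.pair x
  pair_pair x := by
    by_cases hx : x = h ∨ x = G.pair h
    · simp [hx]
    · have h1 : ¬ (G.pair x = h ∨ G.pair x = G.pair h) := by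
        rintro (h1 | h1)
        · exact hx (Or.inr (by rw [← h1, G.pair_pair]))
        · exact hx (Or.inl (by rw [← G.pair_pair x, h1, G.pair_pair]))
      simp only [hx, h1, if_false, G.pair_pair]
  arc := G.arc
  arc_arc := G.arc_arc
  arc_ne := G.arc_ne
  isolated := G.isolated

/-- The disjoint union of `G` with one isolated vertex. -/
def addVertex (G : RibbonGraph H) : RibbonGraph H := { G with isolated := G.isolated + 1 }

section splice

variable (G : RibbonGraph H) (h : H) (σ : H × Bool → H × Bool)

/-- If `y` is a cross of `e`, jump to `σ y` and follow the arc there; otherwise stay at `y`. -/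
def spliceStep [DecidableEq H] (y : H × Bool) : H × Bool :=
  if y.1 = h ∨ y.1 = G.pair h then G.arc (σ y) else y

/-- Follow the arc at `x`, passing through the crosses of `e` by means of `σ`. (As `e` has only
four crosses, at most two passages are needed to reach a cross not on `e`.) -/
def spliceArc [DecidableEq H] (x : H × Bool) : H × Bool :=
  G.spliceStep h σ (G.spliceStep h σ (G.arc x))

/-- `σ` pairs the four crosses of `e` among themselves. -/
structure PairsCrosses : Prop where
  on : ∀ y : H × Bool, G.OnEdge h y.1 → G.OnEdge h (σ y).1
  invol : ∀ y : H × Bool, G.OnEdge h y.1 → σ (σ y) = y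
  ne : ∀ y : H × Bool, G.OnEdge h y.1 → σ y ≠ y
  exhaust : ∀ y y' z : H × Bool, G.OnEdge h y.1 → G.OnEdge h y'.1 → G.OnEdge h z.1 →
    y' ≠ y → y' ≠ σ y → z = y ∨ z = σ y ∨ z = y' ∨ z = σ y'

variable {G h σ}

theorem pairsCrosses_flip (hh : G.pair h ≠ h) : G.PairsCrosses h flip where
  on y hy := hy
  invol y _ := by simp [flip]
  ne y _ := by simp [flip, Prod.ext_iff]
  exhaust := by
    rintro ⟨y, b⟩ ⟨y', b'⟩ ⟨z, c⟩ h1 h2 h3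
    simp only [OnEdge] at h1 h2 h3
    rcases h1 with rfl | rfl <;> rcases h2 with rfl | rfl <;> rcases h3 with rfl | rfl <;>
      cases b <;> cases b' <;> cases c <;> simp_all [flip]

theorem pairsCrosses_strand (hh : G.pair h ≠ h) : G.PairsCrosses h G.strand where
  on y hy := by
    rcases hy with hy | hy
    · exact Or.inr (by simp [strand, hy])
    · exact Or.inl (by simp [strand, hy, G.pair_pair])
  invol y _ := by simp [strand, G.pair_pair]
  ne y hy := by
    rcases y with ⟨y, b⟩
    rcases hy with rfl | rfl
    · simpa [strand] using hh
    · simpa [strand, G.pair_pair] using hh.symm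
  exhaust := by
    rintro ⟨y, b⟩ ⟨y', b'⟩ ⟨z, c⟩ h1 h2 h3
    simp only [OnEdge] at h1 h2 h3
    rcases h1 with rfl | rfl <;> rcases h2 with rfl | rfl <;> rcases h3 with rfl | rfl <;>
      cases b <;> cases b' <;> cases c <;> simp_all [strand, G.pair_pair]

theorem spliceStep_on [DecidableEq H] {y : H × Bool} (hy : G.OnEdge h y.1) :
    G.spliceStep h σ y = G.arc (σ y) := if_pos hy

theorem spliceStep_off [DecidableEq H] {y : H × Bool} (hy : ¬ G.OnEdge h y.1) :
    G.spliceStep h σ y = y := if_neg hy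

theorem arc_inj {x y : H × Bool} (hxy : G.arc x = G.arc y) : x = y := by
  rw [← G.arc_arc x, hxy, G.arc_arc]

/-- The spliced arc ends at a cross not on `e`, is involutive and has no fixed point. -/
theorem spliceArc_spec [DecidableEq H] (P : G.PairsCrosses h σ) {x : H × Bool} (hx : ¬ G.OnEdge h x.1) :
    ¬ G.OnEdge h (G.spliceArc h σ x).1 ∧
      G.spliceArc h σ (G.spliceArc h σ x) = x ∧ G.spliceArc h σ x ≠ x := by
  unfold spliceArc
  by_cases h0 : G.OnEdge h (G.arc x).1
  · set y := G.arc x with hy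
    have hyx : G.arc y = x := by rw [hy, G.arc_arc]
    rw [spliceStep_on h0]
    by_cases h1 : G.OnEdge h (G.arc (σ y)).1
    · set w := G.arc (σ y) with hw
      have hwy : G.arc w = σ y := by rw [hw, G.arc_arc]
      rw [spliceStep_on h1]
      have e1 : w ≠ y := by
        intro e
        rw [e, hyx] at hwy
        exact hx (hwy ▸ P.on y h0)
      have e2 : w ≠ σ y := G.arc_ne (σ y)
      have h2 : ¬ G.OnEdge h (G.arc (σ w)).1 := by
        intro h2
        rcases P.exhaust y w _ h0 h1 h2 e1 e2 with e | e | e | e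
        · have : σ w = x := by rw [← hyx, ← e, G.arc_arc]
          exact hx (this ▸ P.on w h1)
        · exact P.ne w h1 (arc_inj (e.trans hwy.symm))
        · have : σ w = σ y := arc_inj (e.trans hw)
          exact e1 (by rw [← P.invol w h1, this, P.invol y h0])
        · exact G.arc_ne _ e
      refine ⟨h2, ?_, ?_⟩
      · rw [G.arc_arc, spliceStep_on (P.on w h1), P.invol w h1, hwy, spliceStep_on (P.on y h0),
          P.invol y h0, hyx]
      · intro e
        have : σ w = y := by rw [hy, ← e, G.arc_arc]
        exact e2 (by rw [← P.invol w h1, this])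
    · rw [spliceStep_off h1]
      refine ⟨h1, ?_, ?_⟩
      · rw [G.arc_arc, spliceStep_on (P.on y h0), P.invol y h0, hyx, spliceStep_off hx]
      · exact fun e => P.ne y h0 (arc_inj (e.trans hyx.symm))
  · rw [spliceStep_off h0, spliceStep_off h0]
    refine ⟨h0, ?_, G.arc_ne x⟩
    rw [G.arc_arc, spliceStep_off hx, spliceStep_off hx]

theorem not_onEdge (x : G.Rest h) : ¬ G.OnEdge h x.1 := fun hx => hx.elim x.2.1 x.2.2

variable (G h σ)

/-- Remove the two half-ribbons of `e` and reconnect the arcs ending at their crosses by means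
of `σ`. Every closed curve made only of arcs and jumps of `σ` becomes the boundary of a new
isolated vertex disc. -/
noncomputable def splice [DecidableEq H] (P : G.PairsCrosses h σ) : RibbonGraph (G.Rest h) where
  pair x := ⟨G.pair x.1, fun hx => x.2.2 ((G.pair_pair x.1).symm.trans (congrArg G.pair hx)),
    fun hx => x.2.1 ((G.pair_pair x.1).symm.trans ((congrArg G.pair hx).trans (G.pair_pair h)))⟩
  pair_pair x := Subtype.ext (G.pair_pair x.1)
  arc x := (⟨(G.spliceArc h σ (x.1.1, x.2)).1,
    fun e => (spliceArc_spec P (x := (x.1.1, x.2)) (not_onEdge x.1)).1 (Or.inl e),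
    fun e => (spliceArc_spec P (x := (x.1.1, x.2)) (not_onEdge x.1)).1 (Or.inr e)⟩,
    (G.spliceArc h σ (x.1.1, x.2)).2)
  arc_arc x := by
    have := (spliceArc_spec P (x := (x.1.1, x.2)) (not_onEdge x.1)).2.1
    exact Prod.ext (Subtype.ext (congrArg (fun y : H × Bool => y.1) this))
      (congrArg (fun y : H × Bool => y.2) this)
  arc_ne x e := (spliceArc_spec P (x := (x.1.1, x.2)) (not_onEdge x.1)).2.2
    (Prod.ext (congrArg (fun y : G.Rest h × Bool => y.1.1) e)
      (congrArg (fun y : G.Rest h × Bool => y.2) e))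
  isolated := G.isolated + Nat.card
    {q : Quot (fun x y : H × Bool => y = G.arc x ∨ (G.OnEdge h x.1 ∧ y = σ x)) //
      ∀ x, Quot.mk _ x = q → G.OnEdge h x.1}

end splice

variable [DecidableEq H]

/-- The deletion `G - e`: the ribbon `e` is removed and the vertex discs are kept, so that each
segment along which `e` was attached becomes part of an arc of the vertex boundary. -/
noncomputable def delete (G : RibbonGraph H) (h : H) (hh : G.pair h ≠ h) :
    RibbonGraph (G.Rest h) :=
  G.splice h flip (pairsCrosses_flip hh)

/-- The contraction `G / e`: `e` and its end vertices are replaced by one disc for each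
boundary circle of their union, the circles running along the arcs and the strands of `e` and
keeping the remaining half-ribbons in place.

If `e` is not a self-loop, its ends are merged into one vertex carrying the half-ribbons of both in
the same cyclic order. If `e` is an untwisted self-loop, its vertex is split into two vertices, each
carrying the half-ribbons of one of the two sides of `e`. -/
noncomputable def contract (G : RibbonGraph H) (h : H) (hh : G.pair h ≠ h) :
    RibbonGraph (G.Rest h) :=
  G.splice h G.strand (pairsCrosses_strand hh)

/-! ### Types of edges -/

/-- `e` is a self-loop: both its ends are on the same vertex. -/
def IsLoop (G : RibbonGraph H) (h : H) : Prop := G.vert h = G.vert (G.pair h)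

/-- `e` is a bridge: its removal disconnects a component. -/
def IsBridge (G : RibbonGraph H) (h : H) (hh : G.pair h ≠ h) : Prop :=
  G.numComponents < (G.delete h hh).numComponents

/-- `e` is regular: neither a self-loop nor a bridge. -/
def IsRegular (G : RibbonGraph H) (h : H) (hh : G.pair h ≠ h) : Prop :=
  ¬ G.IsLoop h ∧ ¬ G.IsBridge h hh

/-- Two crosses are on the same side of `e`: one passes from one to the other along
a vertex boundary without passing through the segments of `e`. -/
def SameSide (G : RibbonGraph H) (h : H) : H × Bool → H × Bool → Prop :=
  Relation.EqvGen (fun x y => y = G.arc x ∨ (¬ G.OnEdge h x.1 ∧ y = flip x))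

/-- Two crosses are linked off `e`: one passes from one to the other along vertex boundaries
without passing through the segments of `e`, and along edges other than `e`. -/
def LinkedOff (G : RibbonGraph H) (h : H) : H × Bool → H × Bool → Prop :=
  Relation.EqvGen
    (fun x y => y = G.arc x ∨ (¬ G.OnEdge h x.1 ∧ (y = flip x ∨ y = G.strand x)))

/-- A self-loop is untwisted (its union with its vertex is an annulus): a strand of `e` joins the
two ends of one and the same side. -/
def IsUntwistedLoop (G : RibbonGraph H) (h : H) : Prop :=
  G.IsLoop h ∧ G.SameSide h (h, false) (G.pair h, false)

/-- A self-loop is twisted (its union with its vertex is a Möbius band): a strand of `e` joins ends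
of different sides. -/
def IsTwistedLoop (G : RibbonGraph H) (h : H) : Prop :=
  G.IsLoop h ∧ ¬ G.SameSide h (h, false) (G.pair h, false)

/-- A self-loop is trivial: no cycle is interlaced with it, that is, no path outside its vertex
leads from one of its two sides to the other. -/
def IsTrivialLoop (G : RibbonGraph H) (h : H) : Prop :=
  G.IsLoop h ∧ ¬ G.LinkedOff h (h, false) (h, true)

/-- One of the strands of `e` closes immediately: it is joined at its two ends by a single arc,
so that one of the two sides of the (then untwisted and trivial) self-loop `e`
carries no half-ribbon. -/
def HasInnerFace (G : RibbonGraph H) (h : H) : Prop :=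
  ∃ b, G.arc (h, b) = (G.pair h, b)

end RibbonGraph

/-! The sum over c-subgraphs splits according to whether `e` is cut. Those which cut `e` are the
c-subgraphs of `G ∨ e`; only the rank of the ambient graph can differ, and it drops by one exactly
for a bridge, whence the factor `x - 1`. Those which keep `e` are matched with the c-subgraphs of `G
/ e` (or of `G - e`, possibly with an extra disc), so that everything reduces to comparing exponents
term by term (`brPoly_eq_add`, `brTerm_eq`).

Apart from edges, flags and isolated discs, all the numbers involved come from counting classes on
the finite set of crosses. Arcs and segments generate the vertices, and with the strands the
components; arcs, strands and jumps across flags generate the closed faces and the boundary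
components. Deletion and contraction are both splices, in which the crosses of `e` are joined by
segments or by strands respectively. A splice preserves the classes, those lying wholly on `e`
becoming isolated discs (`freeCount_splice`). Hence all comparisons take place on the crosses of
`G`, between relations that differ only in their jumps at the crosses of `e`.

A boundary curve passes `e` along its strands, so contraction preserves closed faces and boundary
components (`boundaryStep_eq`). Contracting a non-loop merges two vertices and keeps the components;
contracting a trivial untwisted loop raises both numbers by one, and the changes of `k` and `n`
cancel in the exponent of `z`. For a trivial twisted loop, the curves off `e` connect its crosses so
that strands and segments alike put all four into one class (`freeCount_boundaryStep_of_twisted`);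
only `n` changes, which gives `(y - 1) z`. The curves needed off `e` exist by parity: two
involutions pairing up a class cannot leave a single cross of `e` alone (`exists_ne_eqvGen`). -/

/-! ### Counting classes of a relation -/

section Classes

open Relation

variable {X : Type*}

/-- The number of classes of the equivalence relation generated by `r` without a point
satisfying `p`. -/
noncomputable def freeCount (r : X → X → Prop) (p : X → Prop) : ℕ :=
  {q : Quot r | ∀ x, Quot.mk r x = q → ¬ p x}.ncard

/-- The number of classes of the equivalence relation generated by `r`. -/
noncomputable def classCount (r : X → X → Prop) : ℕ := Nat.card (Quot r)

theorem freeCount_false (r : X → X → Prop) : freeCount r (fun _ => False) = classCount r := by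
  simp [freeCount, classCount, Set.ncard_univ]

theorem quot_eq_iff {r : X → X → Prop} {x y : X} : Quot.mk r x = Quot.mk r y ↔ EqvGen r x y :=
  ⟨Quot.eqvGen_exact, Quot.eqvGen_sound⟩

/-- The equivalence relation generated by `r` is contained in any equivalence relation
which contains `r`. -/
theorem eqvGen_le {r s : X → X → Prop} (hrs : ∀ x y, r x y → EqvGen s x y) {x y : X}
    (h : EqvGen r x y) : EqvGen s x y := by
  induction h with
  | rel x y h => exact hrs x y h
  | refl x => exact .refl x
  | symm x y _ ih => exact .symm _ _ ih
  | trans x y z _ _ ih1 ih2 => exact .trans _ _ _ ih1 ih2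

/-- A set closed under `r` and its converse is a union of classes. -/
theorem eqvGen_closed {r : X → X → Prop} {S : X → Prop} (hS : ∀ x y, r x y → (S x ↔ S y))
    {x y : X} (h : EqvGen r x y) : S x ↔ S y := by
  induction h with
  | rel x y h => exact hS x y h
  | refl x => exact Iff.rfl
  | symm x y _ ih => exact ih.symm
  | trans x y z _ _ ih1 ih2 => exact ih1.trans ih2

theorem eqvGen_eq {Y : Type*} {r : X → X → Prop} {g : X → Y} (hg : ∀ x y, r x y → g x = g y)
    {x y : X} (h : EqvGen r x y) : g x = g y :=
  congrArg (Quot.lift g hg) (quot_eq_iff.2 h)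

/-- The additional steps of `s` have both ends at `p`-points, so they never touch a class free of
such points. This lets one ignore jumps across flags when counting closed faces, and steps off `e`
when counting curves lying wholly on `e`. -/
theorem freeCount_eq_of_subset {r s : X → X → Prop} {p : X → Prop}
    (hrs : ∀ x y, r x y → EqvGen s x y)
    (hsr : ∀ x y, s x y → EqvGen r x y ∨ (p x ∧ p y)) :
    freeCount r p = freeCount s p := by
  have key : ∀ {x y}, EqvGen s x y → (∀ z, EqvGen r x z → ¬ p z) → EqvGen r x y := by
    intro x y h hx
    have hx' : ∀ a b, s a b → (EqvGen r x a ↔ EqvGen r x b) := by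
      intro a b hab
      rcases hsr a b hab with h | ⟨ha, hb⟩
      · exact ⟨fun h' => h'.trans _ _ _ h, fun h' => h'.trans _ _ _ (h.symm _ _)⟩
      · exact ⟨fun h' => absurd ha (hx a h'), fun h' => absurd hb (hx b h')⟩
    exact (eqvGen_closed hx' h).1 (.refl x)
  let f : Quot r → Quot s := Quot.lift (Quot.mk s) fun x y h => Quot.eqvGen_sound (hrs x y h)
  refine Set.ncard_congr (fun q _ => f q) ?_ ?_ ?_
  · rintro ⟨x⟩ hx y hy hp
    have hyx : EqvGen s x y := (quot_eq_iff.1 hy).symm _ _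
    exact hx y (quot_eq_iff.2 ((key hyx fun z hz => hx z (quot_eq_iff.2 (hz.symm _ _))).symm _ _)) hp
  · rintro ⟨x⟩ ⟨y⟩ hx hy hxy
    exact quot_eq_iff.2 (key (quot_eq_iff.1 hxy) fun z hz => hx z (quot_eq_iff.2 (hz.symm _ _)))
  · rintro ⟨x⟩ hx
    exact ⟨Quot.mk r x, fun y hy => hx y
      (quot_eq_iff.2 (eqvGen_le hrs (quot_eq_iff.1 hy))), rfl⟩

theorem freeCount_congr {r s : X → X → Prop} (p : X → Prop)
    (hrs : ∀ x y, r x y → EqvGen s x y) (hsr : ∀ x y, s x y → EqvGen r x y) :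
    freeCount r p = freeCount s p :=
  freeCount_eq_of_subset hrs fun x y h => Or.inl (hsr x y h)

theorem classCount_congr {r s : X → X → Prop}
    (hrs : ∀ x y, r x y → EqvGen s x y) (hsr : ∀ x y, s x y → EqvGen r x y) :
    classCount r = classCount s := by
  rw [← freeCount_false, freeCount_congr _ hrs hsr, freeCount_false]

theorem classCount_le [Finite X] {r s : X → X → Prop} (hrs : ∀ x y, r x y → EqvGen s x y) :
    classCount s ≤ classCount r := by
  refine Nat.card_le_card_of_surjective
    (Quot.lift (Quot.mk s) fun x y h => Quot.eqvGen_sound (hrs x y h)) ?_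
  rintro ⟨x⟩
  exact ⟨Quot.mk r x, rfl⟩

/-- Joining a class without `p`-points to another class lowers the number of classes without
`p`-points by one. -/
theorem freeCount_add_pair [Finite X] {r s : X → X → Prop} {p : X → Prop} {a b : X}
    (hrs : ∀ x y, r x y → EqvGen s x y)
    (hsr : ∀ x y, s x y → EqvGen (fun x y => r x y ∨ (x = a ∧ y = b)) x y)
    (hs : EqvGen s a b) (hab : ¬ EqvGen r a b) (ha : ∀ x, EqvGen r a x → ¬ p x) :
    freeCount r p = freeCount s p + 1 := by
  classical
  let f : Quot r → Quot s := Quot.lift (Quot.mk s) fun x y h => Quot.eqvGen_sound (hrs x y h)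
  -- Moving the class of `a` onto that of `b` gives a map constant along `s`, which inverts `f` on
  -- the classes other than that of `a`.
  let g : X → Quot r := fun x => if EqvGen r a x then Quot.mk r b else Quot.mk r x
  have hg : ∀ x y, EqvGen s x y → g x = g y := by
    have hstep : ∀ x y, (r x y ∨ (x = a ∧ y = b)) → g x = g y := by
      rintro x y (h | ⟨rfl, rfl⟩)
      · have : EqvGen r a x ↔ EqvGen r a y :=
          ⟨fun h' => h'.trans _ _ _ (.rel _ _ h), fun h' => h'.trans _ _ _ ((EqvGen.rel _ _ h).symm _ _)⟩
        simp only [g, this, Quot.sound h]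
      · simp [g, EqvGen.refl]
    exact fun x y h => eqvGen_eq (fun x y h => eqvGen_eq hstep (hsr x y h)) h
  have hne : ∀ {x}, Quot.mk r x ≠ Quot.mk r a → g x = Quot.mk r x := by
    intro x hx
    exact if_neg fun h => hx (quot_eq_iff.2 (h.symm _ _))
  have hmem : Quot.mk r a ∈ {q : Quot r | ∀ x, Quot.mk r x = q → ¬ p x} :=
    fun x hx => ha x ((quot_eq_iff.1 hx).symm _ _)
  unfold freeCount
  rw [← Set.ncard_sdiff_singleton_add_one hmem (Set.toFinite _)]
  congr 1
  refine Set.ncard_congr (fun q _ => f q) ?_ ?_ ?_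
  · rintro ⟨x⟩ ⟨hx, hxa⟩ y hy
    have h1 : g y = g x := hg _ _ (quot_eq_iff.1 hy)
    rw [hne hxa] at h1
    by_cases hya : EqvGen r a y
    · exact ha y hya
    · exact hx y (by rw [← h1]; exact (if_neg hya).symm)
  · rintro ⟨x⟩ ⟨y⟩ ⟨hx, hxa⟩ ⟨hy, hya⟩ hxy
    have := hg _ _ (quot_eq_iff.1 hxy)
    rwa [hne hxa, hne hya] at this
  · rintro ⟨x⟩ hx
    -- Since the class of `a` has been removed, the joined class must be hit by the class of `b`.
    by_cases hxa : EqvGen r a x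
    · have hsb : EqvGen s b x := (hs.symm _ _).trans _ _ _ (eqvGen_le hrs hxa)
      refine ⟨Quot.mk r b, ⟨fun y hy => hx y (quot_eq_iff.2 ?_), fun h =>
        hab ((quot_eq_iff.1 h).symm _ _)⟩, quot_eq_iff.2 hsb⟩
      exact (eqvGen_le hrs (quot_eq_iff.1 hy)).trans _ _ _ hsb
    · exact ⟨Quot.mk r x, ⟨fun y hy => hx y (quot_eq_iff.2 (eqvGen_le hrs (quot_eq_iff.1 hy))),
        fun h => hxa ((quot_eq_iff.1 h).symm _ _)⟩, rfl⟩

theorem classCount_add_pair [Finite X] {r s : X → X → Prop} {a b : X}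
    (hrs : ∀ x y, r x y → EqvGen s x y)
    (hsr : ∀ x y, s x y → EqvGen (fun x y => r x y ∨ (x = a ∧ y = b)) x y)
    (hs : EqvGen s a b) (hab : ¬ EqvGen r a b) :
    classCount r = classCount s + 1 := by
  rw [← freeCount_false, freeCount_add_pair hrs hsr hs hab (by simp), freeCount_false]

theorem classCount_le_add_pair [Finite X] {r s : X → X → Prop} {a b : X}
    (hrs : ∀ x y, r x y → EqvGen s x y)
    (hsr : ∀ x y, s x y → EqvGen (fun x y => r x y ∨ (x = a ∧ y = b)) x y)
    (hs : EqvGen s a b) : classCount r ≤ classCount s + 1 := by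
  by_cases hab : EqvGen r a b
  · refine (classCount_congr hrs fun x y h => eqvGen_le ?_ (hsr x y h)).le.trans (Nat.le_succ _)
    rintro x y (h | ⟨rfl, rfl⟩)
    exacts [.rel _ _ h, hab]
  · exact (classCount_add_pair hrs hsr hs hab).le

/-- Closed classes and classes with a `p`-point together are all classes. -/
theorem ncard_add_freeCount [Finite X] (r : X → X → Prop) (p : X → Prop) :
    {q : Quot r | ∃ x, Quot.mk r x = q ∧ p x}.ncard + freeCount r p = classCount r := by
  have : {q : Quot r | ∀ x, Quot.mk r x = q → ¬ p x} = {q : Quot r | ∃ x, Quot.mk r x = q ∧ p x}ᶜ := by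
    ext q; simp
  rw [freeCount, this, Set.ncard_add_ncard_compl, classCount]

/-! ### Parity and paths between marked points -/

theorem even_card_of_involution {S : Finset X} {a : X → X} (hS : ∀ x ∈ S, a x ∈ S)
    (ha : ∀ x ∈ S, a (a x) = x) (hne : ∀ x ∈ S, a x ≠ x) : Even S.card := by
  have h : ∑ _x ∈ S, (1 : ZMod 2) = 0 :=
    Finset.sum_involution (fun x _ => a x) (fun _ _ => by decide) (fun x hx _ => hne x hx) hS ha
  rw [Finset.sum_const, nsmul_one] at h
  exact (ZMod.natCast_eq_zero_iff_even).1 h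

/-- If `a` is an involution without fixed points and `τ` one off the set `on`, then each point `x`
of this set is the end of a path leading to another point of the set. -/
theorem exists_ne_eqvGen [Finite X] {a τ : X → X} {on : X → Prop} (ha : ∀ x, a (a x) = x)
    (hane : ∀ x, a x ≠ x) (hτ : ∀ x, ¬ on x → τ (τ x) = x) (hτne : ∀ x, ¬ on x → τ x ≠ x)
    (hτon : ∀ x, ¬ on x → ¬ on (τ x)) {x : X} (hx : on x) :
    ∃ y, on y ∧ y ≠ x ∧ EqvGen (fun x y => y = a x ∨ (¬ on x ∧ y = τ x)) x y := by
  classical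
  have := Fintype.ofFinite X
  -- If `x` were the only marked point of its class `S`, then `a` would pair up `S` and `τ` would
  -- pair up `S` without `x`; both cardinalities would be even.
  by_contra! hcon
  let r : X → X → Prop := fun x y => y = a x ∨ (¬ on x ∧ y = τ x)
  let S : Finset X := Finset.univ.filter (EqvGen r x)
  have hmem : ∀ y, y ∈ S ↔ EqvGen r x y := fun y => by simp [S]
  have hxS : x ∈ S := (hmem x).2 (.refl x)
  have h1 : Even S.card := even_card_of_involution (a := a)
    (fun y hy => (hmem _).2 (((hmem y).1 hy).trans _ _ _ (.rel _ _ (Or.inl rfl))))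
    (fun y _ => ha y) (fun y _ => hane y)
  have hoff : ∀ y ∈ S.erase x, ¬ on y := fun y hy hon =>
    hcon y hon (Finset.ne_of_mem_erase hy) ((hmem y).1 (Finset.mem_of_mem_erase hy))
  have h2 : Even (S.erase x).card := even_card_of_involution (a := τ)
    (fun y hy => Finset.mem_erase.2 ⟨fun h => hτon y (hoff y hy) (h ▸ hx),
      (hmem _).2 (((hmem y).1 (Finset.mem_of_mem_erase hy)).trans _ _ _
        (.rel _ _ (Or.inr ⟨hoff y hy, rfl⟩)))⟩)
    (fun y hy => hτ y (hoff y hy)) (fun y hy => hτne y (hoff y hy))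
  rw [← Finset.card_erase_add_one hxS] at h1
  exact (Nat.even_add_one.1 h1) h2

end Classes

namespace RibbonGraph

open Relation

variable {H : Type*}

/-! ### The numbers of a ribbon graph as numbers of classes of crosses -/

/-- Steps along the vertex boundaries. -/
def VertexStep (G : RibbonGraph H) (x y : H × Bool) : Prop := y = G.arc x ∨ y = flip x

/-- Steps along the vertex boundaries and the edges. -/
def ComponentStep (G : RibbonGraph H) (x y : H × Bool) : Prop :=
  y = G.arc x ∨ y = flip x ∨ y = G.strand x

/-- The jump along the edge, or to the other external point of a flag. -/
def BoundaryJump (G : RibbonGraph H) (x y : H × Bool) : Prop :=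
  y = G.strand x ∨ (G.IsFlag x.1 ∧ y = flip x)

/-- Steps along the closed faces and along the cycles of the boundary graph. -/
def BoundaryStep (G : RibbonGraph H) (x y : H × Bool) : Prop :=
  y = G.arc x ∨ G.BoundaryJump x y

theorem numVertices_eq [Finite H] (G : RibbonGraph H) :
    G.numVertices = classCount G.VertexStep + G.isolated := by
  unfold numVertices Vertex classCount
  rw [Nat.card_sum, Nat.card_fin]
  rfl

theorem numComponents_eq [Finite H] (G : RibbonGraph H) :
    G.numComponents = classCount G.ComponentStep + G.isolated := by
  have e : G.Component ≃ Quot G.ComponentStep ⊕ Fin G.isolated :=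
    { toFun := Quot.lift
        (Sum.map (Quot.lift (Quot.mk _) (by
            rintro x y (h | h)
            exacts [Quot.sound (Or.inl h), Quot.sound (Or.inr (Or.inl h))])) id)
        (by
          rintro _ _ ⟨h, rfl, rfl⟩
          exact congrArg Sum.inl (Quot.sound (Or.inr (Or.inr rfl))))
      invFun := Sum.elim
        (Quot.lift (fun x => Quot.mk _ (Sum.inl (Quot.mk _ x))) (by
          -- `vert` is defined by the cross labelled `false`; the other cross lies on the same
          -- vertex because of the segment between them.
          have hv : ∀ x : H × Bool, (Sum.inl (Quot.mk _ x) : G.Vertex) = G.vert x.1 := by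
            rintro ⟨x, b⟩
            cases b
            · rfl
            · exact congrArg Sum.inl (Quot.sound (Or.inr rfl))
          rintro x y (h | h | h)
          · exact congrArg _ (congrArg Sum.inl (Quot.sound (Or.inl h)))
          · exact congrArg _ (congrArg Sum.inl (Quot.sound (Or.inr h)))
          · subst h
            exact Quot.sound ⟨x.1, hv x, hv (G.strand x)⟩))
        (fun i => Quot.mk _ (Sum.inr i))
      left_inv := by
        rintro ⟨x | i⟩
        · induction x using Quot.ind
          rfl
        · rfl
      right_inv := by
        rintro (x | i)
        · induction x using Quot.ind
          rfl
        · rfl }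
  unfold numComponents
  rw [Nat.card_congr e, Nat.card_sum, Nat.card_fin]
  rfl

/-- A jump across a flag only connects crosses of flags, so `BoundaryStep` has the same flagless
classes as the relation defining `Face`. -/
theorem numClosedFaces_eq [Finite H] (G : RibbonGraph H) :
    G.numClosedFaces = freeCount G.BoundaryStep (fun x => G.IsFlag x.1) + G.isolated := by
  unfold numClosedFaces
  congr 1
  rw [← freeCount_eq_of_subset (r := fun x y : H × Bool => y = G.arc x ∨ y = G.strand x)]
  · refine (Nat.card_congr (Equiv.subtypeEquivRight fun f => ?_)).trans
      (Nat.card_coe_set_eq _)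
    simp only [Face.IsOpen, not_exists, not_and]
    exact ⟨fun h x hx hf => h x hf hx, fun h x hf hx => h x hx hf⟩
  · rintro x y (h | h)
    exacts [.rel _ _ (Or.inl h), .rel _ _ (Or.inr (Or.inl h))]
  · rintro x y (h | h | ⟨h, rfl⟩)
    exacts [Or.inl (.rel _ _ (Or.inl h)), Or.inl (.rel _ _ (Or.inr h)), Or.inr ⟨h, h⟩]

/-- A class of `BoundaryStep` containing a flag alternates between open faces and flags, hence is
one component of the boundary graph; the other classes are closed faces. -/
theorem numBoundaryComponents_eq [Finite H] (G : RibbonGraph H) :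
    G.numBoundaryComponents + freeCount G.BoundaryStep (fun x => G.IsFlag x.1) =
      classCount G.BoundaryStep := by
  rw [← ncard_add_freeCount G.BoundaryStep (fun x => G.IsFlag x.1)]
  congr 1
  have hface : ∀ x y : H × Bool, G.face x = G.face y → EqvGen G.BoundaryStep x y := by
    intro x y h
    refine eqvGen_le ?_ (quot_eq_iff.1 h)
    rintro x y (h | h)
    exacts [.rel _ _ (Or.inl h), .rel _ _ (Or.inr (Or.inl h))]
  have hflip : ∀ g, G.IsFlag g → ∀ b, EqvGen G.BoundaryStep (g, false) (g, b) := by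
    rintro g hg (_ | _)
    exacts [.refl _, .rel _ _ (Or.inr (Or.inr ⟨hg, rfl⟩))]
  let φ : G.BoundaryComponent → Quot G.BoundaryStep :=
    Quot.lift (fun g => Quot.mk _ (g.1, false)) (by
      rintro g h ⟨f, ⟨b, hb⟩, ⟨c, hc⟩⟩
      exact quot_eq_iff.2 (((hflip _ g.2 b).trans _ _ _ (hface _ _ (hb.trans hc.symm))).trans _ _ _
        ((hflip _ h.2 c).symm _ _)))
  -- The components met by the face through `x`. Set values are needed because a closed face meets
  -- none; on a flag the set is a singleton, so invariance of `ψ` along the steps makes `φ`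
  -- injective.
  let ψ : H × Bool → Set G.BoundaryComponent := fun x =>
    {q | ∃ g : {h : H // G.IsFlag h}, Quot.mk _ g = q ∧ ∃ c, G.face (g.1, c) = G.face x}
  have hψflag : ∀ x (hx : G.IsFlag x.1), ψ x = {Quot.mk _ ⟨x.1, hx⟩} := by
    intro x hx
    ext q
    constructor
    · rintro ⟨g, rfl, c, hc⟩
      exact Quot.sound ⟨_, ⟨c, hc⟩, ⟨x.2, rfl⟩⟩
    · rintro rfl
      exact ⟨_, rfl, x.2, rfl⟩
  have hψ : ∀ x y, G.BoundaryStep x y → ψ x = ψ y := by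
    rintro x y (h | h | ⟨h, rfl⟩)
    · have : G.face x = G.face y := Quot.sound (Or.inl h)
      simp only [ψ, this]
    · have : G.face x = G.face y := Quot.sound (Or.inr h)
      simp only [ψ, this]
    · rw [hψflag x h, hψflag (flip x) h]
      rfl
  have hinj : Function.Injective φ := by
    rintro ⟨g⟩ ⟨h⟩ hgh
    have := eqvGen_eq hψ (quot_eq_iff.1 hgh)
    rw [hψflag _ g.2, hψflag _ h.2] at this
    exact Set.singleton_injective this
  have hrange : Set.range φ = {q | ∃ x, Quot.mk G.BoundaryStep x = q ∧ G.IsFlag x.1} := by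
    ext q
    constructor
    · rintro ⟨⟨g⟩, rfl⟩
      exact ⟨_, rfl, g.2⟩
    · rintro ⟨⟨g, b⟩, rfl, hg⟩
      exact ⟨Quot.mk _ ⟨g, hg⟩, quot_eq_iff.2 (hflip g hg b)⟩
  rw [← hrange, ← Set.image_univ, Set.ncard_image_of_injective _ hinj, Set.ncard_univ]
  rfl

/-! ### Splicing -/

section Rest

variable {G : RibbonGraph H} {h : H}

/-- A cross which is not on the edge of `h`, as a cross of the original graph. -/
def restCross (x : G.Rest h × Bool) : H × Bool := (x.1.1, x.2)

theorem restCross_injective : Function.Injective (restCross (G := G) (h := h)) := fun _ _ e =>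
  Prod.ext (Subtype.ext (congrArg (fun z : H × Bool => z.1) e)) (congrArg (fun z : H × Bool => z.2) e)

theorem not_onEdge_restCross (x : G.Rest h × Bool) : ¬ G.OnEdge h (restCross x).1 :=
  not_onEdge x.1

theorem exists_restCross {x : H × Bool} (hx : ¬ G.OnEdge h x.1) :
    ∃ y : G.Rest h × Bool, restCross y = x :=
  ⟨(⟨x.1, fun e => hx (Or.inl e), fun e => hx (Or.inr e)⟩, x.2), rfl⟩

end Rest

section Splice

variable [DecidableEq H] {G : RibbonGraph H} {h : H} {σ : H × Bool → H × Bool}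

/-- Steps along the arcs, by `σ` on the crosses of the edge of `h`, and by `ρ` on the others. -/
def SpliceStep (G : RibbonGraph H) (h : H) (σ : H × Bool → H × Bool)
    (ρ : H × Bool → H × Bool → Prop) (x y : H × Bool) : Prop :=
  y = G.arc x ∨ (G.OnEdge h x.1 ∧ y = σ x) ∨
    (¬ G.OnEdge h x.1 ∧ ¬ G.OnEdge h y.1 ∧ ρ x y)

theorem restCross_splice_arc (P : G.PairsCrosses h σ) (x : G.Rest h × Bool) :
    restCross ((G.splice h σ P).arc x) = G.spliceArc h σ (restCross x) := rfl

theorem eqvGen_spliceArc {ρ : H × Bool → H × Bool → Prop} (x : H × Bool) :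
    EqvGen (G.SpliceStep h σ ρ) x (G.spliceArc h σ x) := by
  have hs : ∀ y, EqvGen (G.SpliceStep h σ ρ) y (G.spliceStep h σ y) := by
    intro y
    by_cases hy : G.OnEdge h y.1
    · rw [spliceStep_on hy]
      exact .trans _ _ _ (.rel _ _ (Or.inr (Or.inl ⟨hy, rfl⟩))) (.rel _ _ (Or.inl rfl))
    · rw [spliceStep_off hy]
      exact .refl _
  exact .trans _ _ _ (.trans _ _ _ (.rel _ _ (Or.inl rfl)) (hs _)) (hs _)

/-- A class of crosses connected only by arcs and `σ` contains at most two crosses off `e`. -/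
theorem eq_or_eq_spliceArc (P : G.PairsCrosses h σ) {x y : H × Bool} (hx : ¬ G.OnEdge h x.1)
    (hy : ¬ G.OnEdge h y.1) (hxy : EqvGen (G.SpliceStep h σ fun _ _ => False) x y) :
    y = x ∨ y = G.spliceArc h σ x := by
  -- It suffices to list a set containing `x` and stable under arcs and `σ`. The three cases below
  -- take the path from `x` to its exit with two, one or no passages through `e`.
  have key : ∀ S : H × Bool → Prop, S x → (∀ z, S z → S (G.arc z)) →
      (∀ z, S z → G.OnEdge h z.1 → S (σ z)) → S y := by
    intro S hSx hSa hSσ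
    refine (eqvGen_closed ?_ hxy).1 hSx
    rintro z w (rfl | ⟨hz, rfl⟩ | ⟨-, -, hf⟩)
    · exact ⟨hSa z, fun h' => G.arc_arc z ▸ hSa _ h'⟩
    · exact ⟨fun h' => hSσ z h' hz, fun h' => P.invol z hz ▸ hSσ _ h' (P.on z hz)⟩
    · exact hf.elim
  have hspec := (spliceArc_spec P hx).1
  by_cases h0 : G.OnEdge h (G.arc x).1
  · by_cases h1 : G.OnEdge h (G.arc (σ (G.arc x))).1
    · have e : G.spliceArc h σ x = G.arc (σ (G.arc (σ (G.arc x)))) := by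
        rw [spliceArc, spliceStep_on h0, spliceStep_on h1]
      rw [e] at hspec ⊢
      have := key (fun z => z = x ∨ z = G.arc x ∨ z = σ (G.arc x) ∨ z = G.arc (σ (G.arc x)) ∨
        z = σ (G.arc (σ (G.arc x))) ∨ z = G.arc (σ (G.arc (σ (G.arc x))))) (Or.inl rfl)
        (by rintro z (rfl | rfl | rfl | rfl | rfl | rfl) <;> simp [G.arc_arc])
        (by
          rintro z (rfl | rfl | rfl | rfl | rfl | rfl) hz
          · exact absurd hz hx
          · simp
          · simp [P.invol _ h0]
          · simp
          · simp [P.invol _ h1]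
          · exact absurd hz hspec)
      rcases this with h' | rfl | rfl | rfl | rfl | h'
      · exact Or.inl h'
      · exact absurd h0 hy
      · exact absurd (P.on _ h0) hy
      · exact absurd h1 hy
      · exact absurd (P.on _ h1) hy
      · exact Or.inr h'
    · have e : G.spliceArc h σ x = G.arc (σ (G.arc x)) := by
        rw [spliceArc, spliceStep_on h0, spliceStep_off h1]
      rw [e]
      have := key (fun z => z = x ∨ z = G.arc x ∨ z = σ (G.arc x) ∨ z = G.arc (σ (G.arc x)))
        (Or.inl rfl)
        (by rintro z (rfl | rfl | rfl | rfl) <;> simp [G.arc_arc])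
        (by
          rintro z (rfl | rfl | rfl | rfl) hz
          · exact absurd hz hx
          · simp
          · simp [P.invol _ h0]
          · exact absurd hz h1)
      rcases this with h' | rfl | rfl | h'
      · exact Or.inl h'
      · exact absurd h0 hy
      · exact absurd (P.on _ h0) hy
      · exact Or.inr h'
  · have e : G.spliceArc h σ x = G.arc x := by
      rw [spliceArc, spliceStep_off h0, spliceStep_off h0]
    rw [e]
    exact key (fun z => z = x ∨ z = G.arc x) (Or.inl rfl)
      (by rintro z (rfl | rfl) <;> simp [G.arc_arc])
      (by
        rintro z (rfl | rfl) hz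
        exacts [absurd hz hx, absurd hz h0])

/-- Crosses off `e` are connected in the spliced graph if and only if they are connected
before splicing. -/
theorem eqvGen_splice_iff (P : G.PairsCrosses h σ) (ρ : H × Bool → H × Bool → Prop)
    (x y : G.Rest h × Bool) :
    EqvGen (fun x y => y = (G.splice h σ P).arc x ∨ ρ (restCross x) (restCross y)) x y ↔
      EqvGen (G.SpliceStep h σ ρ) (restCross x) (restCross y) := by
  set r : G.Rest h × Bool → G.Rest h × Bool → Prop :=
    fun x y => y = (G.splice h σ P).arc x ∨ ρ (restCross x) (restCross y) with hr
  constructor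
  · intro hxy
    induction hxy with
    | rel x y hxy =>
      rcases hxy with rfl | hxy
      · exact eqvGen_spliceArc _
      · exact .rel _ _ (Or.inr (Or.inr ⟨not_onEdge_restCross x, not_onEdge_restCross y, hxy⟩))
    | refl x => exact .refl _
    | symm x y _ ih => exact .symm _ _ ih
    | trans x y z _ _ ih1 ih2 => exact .trans _ _ _ ih1 ih2
  · intro hxy
    let U := G.SpliceStep h σ fun _ _ => False
    -- The classes of the spliced graph reachable from `z` by arcs and `σ` alone. As the path
    -- through a cross off `e` has only its two ends off `e`, joined by the spliced arc, this is a
    -- singleton there; its invariance transports connections back to the spliced graph.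
    let K : H × Bool → Set (Quot r) := fun z =>
      {q | ∃ w : G.Rest h × Bool, Quot.mk r w = q ∧ EqvGen U z (restCross w)}
    have hKU : ∀ z w, U z w → K z = K w := by
      intro z w hzw
      have : ∀ u, EqvGen U z u ↔ EqvGen U w u := fun u =>
        ⟨fun h' => ((EqvGen.rel _ _ hzw).symm _ _).trans _ _ _ h',
          fun h' => (EqvGen.rel _ _ hzw).trans _ _ _ h'⟩
      simp only [K, this]
    have hKrest : ∀ w : G.Rest h × Bool, K (restCross w) = {Quot.mk r w} := by
      intro w
      ext q
      constructor
      · rintro ⟨u, rfl, hu⟩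
        rcases eq_or_eq_spliceArc P (not_onEdge_restCross w) (not_onEdge_restCross u) hu with e | e
        · rw [restCross_injective e]
          rfl
        · rw [← restCross_splice_arc P] at e
          rw [restCross_injective e]
          exact (show Quot.mk r w = Quot.mk r _ from Quot.sound (Or.inl rfl)).symm
      · rintro rfl
        exact ⟨w, rfl, .refl _⟩
    have hK : ∀ z w, G.SpliceStep h σ ρ z w → K z = K w := by
      rintro z w (hzw | hzw | ⟨hz, hw, hzw⟩)
      · exact hKU z w (Or.inl hzw)
      · exact hKU z w (Or.inr (Or.inl hzw))
      · obtain ⟨z, rfl⟩ := exists_restCross hz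
        obtain ⟨w, rfl⟩ := exists_restCross hw
        rw [hKrest, hKrest]
        exact congrArg _ (Quot.sound (Or.inr hzw))
    have := eqvGen_eq hK hxy
    rw [hKrest, hKrest] at this
    exact quot_eq_iff.1 (Set.singleton_injective this)

/-- Steps of `ρ` are only taken off `e`, so they do not affect the curves made of crosses of `e`
alone; the count is the same for every `ρ`. -/
theorem splice_isolated (P : G.PairsCrosses h σ) (ρ : H × Bool → H × Bool → Prop) :
    (G.splice h σ P).isolated =
      G.isolated + freeCount (G.SpliceStep h σ ρ) (fun x => ¬ G.OnEdge h x.1) := by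
  rw [← freeCount_eq_of_subset
    (r := fun x y : H × Bool => y = G.arc x ∨ (G.OnEdge h x.1 ∧ y = σ x))]
  · change G.isolated + Nat.card _ = _
    congr 1
    rw [freeCount, ← Nat.card_coe_set_eq]
    simp only [not_not]
    rfl
  · rintro x y (h | h)
    exacts [.rel _ _ (Or.inl h), .rel _ _ (Or.inr (Or.inl h))]
  · rintro x y (h | h | ⟨hx, hy, -⟩)
    exacts [Or.inl (.rel _ _ (Or.inl h)), Or.inl (.rel _ _ (Or.inr h)), Or.inr ⟨hx, hy⟩]

/-- Splicing does not change the number of classes of crosses, when the new isolated discs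
are included. -/
theorem freeCount_splice [Finite H] (P : G.PairsCrosses h σ) (ρ : H × Bool → H × Bool → Prop)
    {p : H × Bool → Prop} (hp : ∀ x, p x → ¬ G.OnEdge h x.1) :
    freeCount (fun x y => y = (G.splice h σ P).arc x ∨ ρ (restCross x) (restCross y))
        (fun x => p (restCross x)) + (G.splice h σ P).isolated =
      freeCount (G.SpliceStep h σ ρ) p + G.isolated := by
  rw [splice_isolated P ρ, ← add_assoc, add_right_comm, add_right_cancel_iff]
  set r : G.Rest h × Bool → G.Rest h × Bool → Prop :=
    fun x y => y = (G.splice h σ P).arc x ∨ ρ (restCross x) (restCross y) with hr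
  set s := G.SpliceStep h σ ρ with hs
  have hdisj : Disjoint {q : Quot s | (∀ x, Quot.mk s x = q → ¬ p x) ∧
        ∃ x, Quot.mk s x = q ∧ ¬ G.OnEdge h x.1}
      {q : Quot s | ∀ x, Quot.mk s x = q → ¬ ¬ G.OnEdge h x.1} := by
    rw [Set.disjoint_left]
    rintro q ⟨-, x, hx, hox⟩ hq
    exact hq x hx hox
  -- A class free of `p`-points either meets the crosses off `e`, and survives as a class of the
  -- spliced graph, or lies wholly on `e` and becomes a new disc. By `hp` a class of the second kind
  -- is automatically free of `p`-points.
  have hunion : {q : Quot s | ∀ x, Quot.mk s x = q → ¬ p x} =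
      {q : Quot s | (∀ x, Quot.mk s x = q → ¬ p x) ∧ ∃ x, Quot.mk s x = q ∧ ¬ G.OnEdge h x.1} ∪
      {q : Quot s | ∀ x, Quot.mk s x = q → ¬ ¬ G.OnEdge h x.1} := by
    ext q
    simp only [Set.mem_ofPred_eq, Set.mem_union]
    constructor
    · intro hq
      by_cases hx : ∃ x, Quot.mk s x = q ∧ ¬ G.OnEdge h x.1
      · exact Or.inl ⟨hq, hx⟩
      · push Not at hx
        exact Or.inr fun x hxq => not_not.2 (hx x hxq)
    · rintro (hq | hq) x hx
      · exact hq.1 x hx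
      · exact fun hpx => hq x hx (hp x hpx)
  rw [freeCount, freeCount, freeCount, hunion, Set.ncard_union_eq hdisj]
  congr 1
  let f : Quot r → Quot s := Quot.lift (fun x => Quot.mk s (restCross x)) fun x y hxy =>
    quot_eq_iff.2 ((eqvGen_splice_iff P ρ x y).1 (.rel _ _ hxy))
  refine Set.ncard_congr (fun q _ => f q) ?_ ?_ ?_
  · rintro ⟨x⟩ hx
    refine ⟨fun y hy hpy => ?_, restCross x, rfl, not_onEdge_restCross x⟩
    obtain ⟨y, rfl⟩ := exists_restCross (hp y hpy)
    exact hx y (quot_eq_iff.2 ((eqvGen_splice_iff P ρ y x).2 (quot_eq_iff.1 hy))) hpy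
  · rintro ⟨x⟩ ⟨y⟩ - - hxy
    exact quot_eq_iff.2 ((eqvGen_splice_iff P ρ x y).2 (quot_eq_iff.1 hxy))
  · rintro q ⟨hq, x, rfl, hx⟩
    obtain ⟨x, rfl⟩ := exists_restCross hx
    exact ⟨Quot.mk r x, fun y hy => hq _
      (quot_eq_iff.2 ((eqvGen_splice_iff P ρ y x).1 (quot_eq_iff.1 hy))), rfl⟩

theorem classCount_splice [Finite H] (P : G.PairsCrosses h σ) (ρ : H × Bool → H × Bool → Prop) :
    classCount (fun x y => y = (G.splice h σ P).arc x ∨ ρ (restCross x) (restCross y)) +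
        (G.splice h σ P).isolated =
      classCount (G.SpliceStep h σ ρ) + G.isolated := by
  simpa only [freeCount_false] using freeCount_splice P ρ (p := fun _ => False) (by simp)

end Splice

end RibbonGraph

namespace RibbonGraph

open Relation

variable {H : Type*}

/-! ### Edges of cut and spliced graphs -/

theorem onEdge_pair_iff {G : RibbonGraph H} {h x : H} : G.OnEdge h (G.pair x) ↔ G.OnEdge h x := by
  have key : ∀ y, G.OnEdge h y → G.OnEdge h (G.pair y) := by
    rintro y (rfl | rfl)
    exacts [Or.inr rfl, Or.inl (G.pair_pair h)]
  exact ⟨fun hx => G.pair_pair x ▸ key _ hx, key x⟩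

theorem sym2_pair_eq_iff {G : RibbonGraph H} {h x : H} :
    s(x, G.pair x) = s(h, G.pair h) ↔ G.OnEdge h x := by
  rw [Sym2.eq_iff]
  constructor
  · rintro (⟨h1, -⟩ | ⟨h1, -⟩)
    exacts [Or.inl h1, Or.inr h1]
  · rintro (rfl | rfl)
    exacts [Or.inl ⟨rfl, rfl⟩, Or.inr ⟨rfl, G.pair_pair h⟩]

theorem mem_edges [Fintype H] [DecidableEq H] {G : RibbonGraph H} {s : Sym2 H} :
    s ∈ G.edges ↔ ∃ x, G.pair x ≠ x ∧ s(x, G.pair x) = s := by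
  simp [edges]

variable [DecidableEq H]

theorem sub_pair (G : RibbonGraph H) (A : Finset (Sym2 H)) (x : H) :
    (G.sub A).pair x = if s(x, G.pair x) ∈ A then G.pair x else x := rfl

theorem sub_pair_eq_or (G : RibbonGraph H) (A : Finset (Sym2 H)) (x : H) :
    (G.sub A).pair x = G.pair x ∨ (G.sub A).pair x = x := by
  rw [sub_pair]
  split_ifs
  exacts [Or.inl rfl, Or.inr rfl]

theorem sub_insert_pair_on (G : RibbonGraph H) {h x : H} (A : Finset (Sym2 H))
    (hx : G.OnEdge h x) : (G.sub (insert s(h, G.pair h) A)).pair x = G.pair x :=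
  if_pos (Finset.mem_insert.2 (Or.inl (sym2_pair_eq_iff.2 hx)))

theorem sub_insert_pair_off (G : RibbonGraph H) {h x : H} (A : Finset (Sym2 H))
    (hx : ¬ G.OnEdge h x) : (G.sub (insert s(h, G.pair h) A)).pair x = (G.sub A).pair x := by
  simp only [sub_pair, Finset.mem_insert, sym2_pair_eq_iff, hx, false_or]

theorem cut_pair_on {G : RibbonGraph H} {h x : H} (hx : G.OnEdge h x) : (G.cut h).pair x = x :=
  if_pos hx

theorem cut_pair_off {G : RibbonGraph H} {h x : H} (hx : ¬ G.OnEdge h x) :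
    (G.cut h).pair x = G.pair x := if_neg hx

omit [DecidableEq H] in
theorem ext_pair {G K : RibbonGraph H} (hp : ∀ x, G.pair x = K.pair x) (ha : G.arc = K.arc)
    (hi : G.isolated = K.isolated) : G = K := by
  have : G.pair = K.pair := funext hp
  cases G
  cases K
  simp_all

variable [Fintype H]

theorem edges_sub {G : RibbonGraph H} {A : Finset (Sym2 H)} (hA : A ⊆ G.edges) :
    (G.sub A).edges = A := by
  ext s
  rw [mem_edges]
  constructor
  · rintro ⟨x, hx, rfl⟩
    by_cases hm : s(x, G.pair x) ∈ A
    · rw [sub_pair, if_pos hm]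
      exact hm
    · exact absurd (if_neg hm) hx
  · intro hs
    obtain ⟨x, hx, rfl⟩ := mem_edges.1 (hA hs)
    exact ⟨x, by rwa [sub_pair, if_pos hs], by rw [sub_pair, if_pos hs]⟩

theorem edges_eq_insert {G : RibbonGraph H} {h : H} (hh : G.pair h ≠ h) :
    G.edges = insert s(h, G.pair h) (G.cut h).edges := by
  ext s
  rw [Finset.mem_insert, mem_edges, mem_edges]
  constructor
  · rintro ⟨x, hx, rfl⟩
    by_cases ho : G.OnEdge h x
    · exact Or.inl (sym2_pair_eq_iff.2 ho)
    · exact Or.inr ⟨x, by rwa [cut_pair_off ho], by rw [cut_pair_off ho]⟩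
  · rintro (rfl | ⟨x, hx, rfl⟩)
    · exact ⟨h, hh, rfl⟩
    · have ho : ¬ G.OnEdge h x := fun ho => hx (cut_pair_on ho)
      rw [cut_pair_off ho] at hx ⊢
      exact ⟨x, hx, rfl⟩

theorem not_mem_edges_cut {G : RibbonGraph H} {h : H} :
    s(h, G.pair h) ∉ (G.cut h).edges := by
  rw [mem_edges]
  rintro ⟨x, hx, he⟩
  have ho : ¬ G.OnEdge h x := fun ho => hx (cut_pair_on ho)
  rw [cut_pair_off ho] at he
  exact ho (sym2_pair_eq_iff.1 he)

theorem sub_cut {G : RibbonGraph H} {h : H} {B : Finset (Sym2 H)} (hB : B ⊆ (G.cut h).edges) :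
    (G.cut h).sub B = G.sub B := by
  refine ext_pair (fun x => ?_) rfl rfl
  by_cases ho : G.OnEdge h x
  · rw [sub_pair, sub_pair, cut_pair_on ho, sym2_pair_eq_iff.2 ho, ite_self,
      if_neg fun hm => not_mem_edges_cut (hB hm)]
  · rw [sub_pair, sub_pair, cut_pair_off ho]

/-- A set of edges between half-ribbons not on the edge of `h`, as edges of the larger graph. -/
def liftEdges {G : RibbonGraph H} {h : H} (A : Finset (Sym2 (G.Rest h))) : Finset (Sym2 H) :=
  A.image (Sym2.map Subtype.val)

omit [DecidableEq H] [Fintype H] in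
theorem sym2_map_val_injective {G : RibbonGraph H} {h : H} :
    Function.Injective (Sym2.map (Subtype.val : G.Rest h → H)) :=
  Sym2.map.injective Subtype.val_injective

omit [Fintype H] in
theorem mk_mem_liftEdges {G : RibbonGraph H} {h : H} {A : Finset (Sym2 (G.Rest h))}
    (x y : G.Rest h) : s(x.1, y.1) ∈ liftEdges A ↔ s(x, y) ∈ A := by
  rw [liftEdges, ← Sym2.map_mk]
  exact sym2_map_val_injective.mem_finset_image

omit [Fintype H] in
theorem not_mem_liftEdges {G : RibbonGraph H} {h : H} (A : Finset (Sym2 (G.Rest h))) :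
    s(h, G.pair h) ∉ liftEdges A := by
  intro hm
  obtain ⟨z, -, hz⟩ := Finset.mem_image.1 hm
  have : h ∈ Sym2.map Subtype.val z := hz ▸ Sym2.mem_mk_left _ _
  obtain ⟨x, -, hx⟩ := Sym2.mem_map.1 this
  exact x.2.1 hx

omit [Fintype H] in
theorem card_liftEdges {G : RibbonGraph H} {h : H} (A : Finset (Sym2 (G.Rest h))) :
    (liftEdges A).card = A.card :=
  Finset.card_image_of_injective _ sym2_map_val_injective

omit [Fintype H] in
theorem sub_liftEdges_pair {G : RibbonGraph H} {h : H} {K : RibbonGraph (G.Rest h)}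
    (hK : ∀ x, (K.pair x).1 = G.pair x.1) (A : Finset (Sym2 (G.Rest h))) (x : G.Rest h) :
    ((K.sub A).pair x).1 = (G.sub (insert s(h, G.pair h) (liftEdges A))).pair x.1 := by
  rw [sub_insert_pair_off _ _ (not_onEdge x), sub_pair, sub_pair, ← hK]
  simp only [mk_mem_liftEdges]
  split_ifs <;> rfl

theorem liftEdges_edges {G : RibbonGraph H} {h : H} {K : RibbonGraph (G.Rest h)}
    (hK : ∀ x, (K.pair x).1 = G.pair x.1) : liftEdges K.edges = (G.cut h).edges := by
  ext s
  rw [liftEdges, Finset.mem_image, mem_edges]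
  constructor
  · rintro ⟨t, ht, rfl⟩
    obtain ⟨x, hx, rfl⟩ := mem_edges.1 ht
    have hc : (G.cut h).pair x.1 = (K.pair x).1 := by rw [cut_pair_off (not_onEdge x), hK]
    exact ⟨x.1, fun e => hx (Subtype.ext (hc.symm.trans e)), by rw [hc]; rfl⟩
  · rintro ⟨x, hx, rfl⟩
    have ho : ¬ G.OnEdge h x := fun ho => hx (cut_pair_on ho)
    let y : G.Rest h := ⟨x, fun e => ho (Or.inl e), fun e => ho (Or.inr e)⟩
    have hc : (G.cut h).pair x = (K.pair y).1 := by rw [cut_pair_off ho, hK]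
    exact ⟨s(y, K.pair y), mem_edges.2 ⟨y, fun e => hx (hc.trans (congrArg Subtype.val e)), rfl⟩,
      by rw [hc]; rfl⟩

/-! ### The terms of the polynomial -/

open LaurentPolynomial in
/-- The term of `ℛ_G` belonging to the edge set `A`. -/
noncomputable def brTerm (G : RibbonGraph H) (A : Finset (Sym2 H)) :
    LaurentPolynomial (MvPolynomial (Fin 4) ℤ) :=
  C ((MvPolynomial.X 0 - 1) ^ (G.rank - (G.sub A).rank)
      * (MvPolynomial.X 1 - 1) ^ (G.sub A).nullity)
    * T (((G.sub A).numComponents : ℤ) - (G.sub A).numClosedFaces + (G.sub A).nullity)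
    * C (MvPolynomial.X 2 ^ (G.sub A).numBoundaryComponents
      * MvPolynomial.X 3 ^ (G.sub A).numFlags)

theorem brPoly_eq_sum (G : RibbonGraph H) : G.brPoly = ∑ A ∈ G.edges.powerset, G.brTerm A := rfl

-- The numbers `i`, `j`, `m` are the excesses in the exponents of `x - 1`, `y - 1` and `z`; this
-- turns each case of the recursion into arithmetic on exponents.
open LaurentPolynomial in
theorem brTerm_eq {H' : Type*} [Fintype H'] [DecidableEq H'] (G : RibbonGraph H)
    (G' : RibbonGraph H') (A : Finset (Sym2 H)) (A' : Finset (Sym2 H')) (i j : ℕ) (m : ℤ)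
    (hr : G.rank - (G.sub A).rank = i + (G'.rank - (G'.sub A').rank))
    (hn : (G.sub A).nullity = j + (G'.sub A').nullity)
    (hz : ((G.sub A).numComponents : ℤ) - (G.sub A).numClosedFaces + (G.sub A).nullity =
      m + (((G'.sub A').numComponents : ℤ) - (G'.sub A').numClosedFaces + (G'.sub A').nullity))
    (hb : (G.sub A).numBoundaryComponents = (G'.sub A').numBoundaryComponents)
    (hf : (G.sub A).numFlags = (G'.sub A').numFlags) :
    G.brTerm A = C ((MvPolynomial.X 0 - 1) ^ i * (MvPolynomial.X 1 - 1) ^ j) * T m *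
      G'.brTerm A' := by
  unfold brTerm
  rw [hz, hr, hn, hb, hf, T_add, pow_add, pow_add]
  simp only [map_mul]
  ring

/-- The edge sets avoiding `e` are those of `G ∨ e`, and the edge sets containing it are those of
`K` with `e` added. Only the pairing of `K` is prescribed, so contraction, deletion and deletion
with an extra disc are all covered. -/
theorem brPoly_eq_add {G : RibbonGraph H} {h : H} (hh : G.pair h ≠ h)
    {K : RibbonGraph (G.Rest h)} (hK : ∀ x, (K.pair x).1 = G.pair x.1)
    {u v : LaurentPolynomial (MvPolynomial (Fin 4) ℤ)}
    (h0 : ∀ B ⊆ (G.cut h).edges, G.brTerm B = u * (G.cut h).brTerm B)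
    (h1 : ∀ A ⊆ K.edges, G.brTerm (insert s(h, G.pair h) (liftEdges A)) = v * K.brTerm A) :
    G.brPoly = u * (G.cut h).brPoly + v * K.brPoly := by
  rw [brPoly_eq_sum, edges_eq_insert hh, Finset.sum_powerset_insert not_mem_edges_cut,
    brPoly_eq_sum, brPoly_eq_sum, Finset.mul_sum, Finset.mul_sum]
  congr 1
  · exact Finset.sum_congr rfl fun B hB => h0 B (Finset.mem_powerset.1 hB)
  · rw [← liftEdges_edges hK, liftEdges, Finset.powerset_image,
      Finset.sum_image fun A _ B _ e => Finset.image_injective sym2_map_val_injective e]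
    exact Finset.sum_congr rfl fun A hA => h1 A (Finset.mem_powerset.1 hA)

/-! ### Components of subgraphs -/

omit [DecidableEq H] in
theorem numComponents_le_numVertices (G : RibbonGraph H) : G.numComponents ≤ G.numVertices := by
  rw [numComponents_eq, numVertices_eq]
  refine Nat.add_le_add_right (classCount_le ?_) _
  rintro x y (h | h)
  exacts [.rel _ _ (Or.inl h), .rel _ _ (Or.inr (Or.inl h))]

omit [DecidableEq H] in
/-- Cutting edges does not lower the number of components. -/
theorem numComponents_le_of_pair {G K : RibbonGraph H} (ha : K.arc = G.arc)
    (hi : K.isolated = G.isolated) (hp : ∀ x, K.pair x = G.pair x ∨ K.pair x = x) :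
    G.numComponents ≤ K.numComponents := by
  rw [numComponents_eq, numComponents_eq, hi]
  refine Nat.add_le_add_right (classCount_le ?_) _
  rintro x y (h | h | rfl)
  · exact .rel _ _ (Or.inl (ha ▸ h))
  · exact .rel _ _ (Or.inr (Or.inl h))
  · rcases hp x.1 with e | e
    · exact .rel _ _ (Or.inr (Or.inr (by simp [strand, e])))
    · simp only [strand, e]
      exact .refl _

omit [DecidableEq H] [Fintype H] in
theorem eqvGen_componentStep (G : RibbonGraph H) (x : H) (b c : Bool) :
    EqvGen G.ComponentStep (x, b) (x, c) := by
  cases b <;> cases c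
  exacts [.refl _, .rel _ _ (Or.inr (Or.inl rfl)), .rel _ _ (Or.inr (Or.inl rfl)), .refl _]

omit [DecidableEq H] in
/-- Cutting one edge raises the number of components by at most one. -/
theorem numComponents_le_add_one {G K : RibbonGraph H} (ha : K.arc = G.arc)
    (hi : K.isolated = G.isolated) (hp : ∀ x, K.pair x = G.pair x ∨ K.pair x = x) (h : H)
    (hoff : ∀ x, ¬ G.OnEdge h x → K.pair x = G.pair x) :
    K.numComponents ≤ G.numComponents + 1 := by
  rw [numComponents_eq, numComponents_eq, hi, add_right_comm]
  refine Nat.add_le_add_right (classCount_le_add_pair (a := (h, false)) (b := (G.pair h, false))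
    ?_ ?_ (.rel _ _ (Or.inr (Or.inr rfl)))) _
  · rintro x y (h | h | rfl)
    · exact .rel _ _ (Or.inl (ha ▸ h))
    · exact .rel _ _ (Or.inr (Or.inl h))
    · rcases hp x.1 with e | e
      · exact .rel _ _ (Or.inr (Or.inr (by simp [strand, e])))
      · simp only [strand, e]
        exact .refl _
  · have hle : ∀ {x y}, EqvGen K.ComponentStep x y →
        EqvGen (fun x y => K.ComponentStep x y ∨ (x = (h, false) ∧ y = (G.pair h, false))) x y :=
      fun h' => eqvGen_le (fun x y h => .rel _ _ (Or.inl h)) h'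
    -- One link restores both strands of the edge, since the segments at its ends connect the two
    -- labels.
    have hpair : ∀ b, EqvGen (fun x y => K.ComponentStep x y ∨
        (x = (h, false) ∧ y = (G.pair h, false))) (h, b) (G.pair h, b) := fun b =>
      .trans _ _ _ (hle (eqvGen_componentStep K h b false))
        (.trans _ _ _ (.rel _ _ (Or.inr ⟨rfl, rfl⟩)) (hle (eqvGen_componentStep K _ false b)))
    rintro x y (h' | h' | rfl)
    · exact .rel _ _ (Or.inl (Or.inl (ha ▸ h')))
    · exact .rel _ _ (Or.inl (Or.inr (Or.inl h')))
    · by_cases ho : G.OnEdge h x.1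
      · obtain ⟨x, b⟩ := x
        rcases ho with rfl | rfl
        · exact hpair b
        · simp only [strand, G.pair_pair]
          exact (hpair b).symm _ _
      · exact .rel _ _ (Or.inl (Or.inr (Or.inr (by simp [strand, hoff _ ho]))))

/-- With no edges kept there is one component per vertex, and each restored edge lowers their number
by at most one. Hence the natural-number subtraction in the nullity is never truncated. -/
theorem numVertices_le_card_add (G : RibbonGraph H) {A : Finset (Sym2 H)} (hA : A ⊆ G.edges) :
    G.numVertices ≤ A.card + (G.sub A).numComponents := by
  induction A using Finset.induction_on with
  | empty =>
    rw [Finset.card_empty, zero_add, numComponents_eq, numVertices_eq]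
    refine Nat.add_le_add_right (classCount_le ?_) _
    rintro x y (h | h | rfl)
    · exact .rel _ _ (Or.inl h)
    · exact .rel _ _ (Or.inr h)
    · rw [strand, sub_pair, if_neg (Finset.notMem_empty _)]
      exact .refl _
  | insert e A he ih =>
    obtain ⟨h, -, rfl⟩ := mem_edges.1 (hA (Finset.mem_insert_self _ _))
    have h1 := ih fun s hs => hA (Finset.mem_insert_of_mem hs)
    have h2 : (G.sub A).numComponents ≤
        (G.sub (insert s(h, G.pair h) A)).numComponents + 1 := by
      refine numComponents_le_add_one rfl rfl (fun x => ?_) h fun x hx => ?_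
      · by_cases hm : s(x, G.pair x) ∈ A
        · left
          rw [sub_pair, sub_pair, if_pos hm, if_pos (Finset.mem_insert_of_mem hm)]
        · exact Or.inr (if_neg hm)
      · rw [OnEdge, sub_insert_pair_on _ _ (Or.inl rfl)] at hx
        exact (sub_insert_pair_off G A hx).symm
    rw [Finset.card_insert_of_notMem he]
    omega

theorem nullity_sub {G : RibbonGraph H} {A : Finset (Sym2 H)} (hA : A ⊆ G.edges) :
    (G.sub A).nullity = A.card + (G.sub A).numComponents - G.numVertices := by
  unfold nullity
  rw [edges_sub hA]
  rfl

theorem numComponents_le_cut (G : RibbonGraph H) (h : H) :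
    G.numComponents ≤ (G.cut h).numComponents := by
  refine numComponents_le_of_pair rfl rfl fun x => ?_
  by_cases hx : G.OnEdge h x
  exacts [Or.inr (cut_pair_on hx), Or.inl (cut_pair_off hx)]

theorem numComponents_cut_le (G : RibbonGraph H) (h : H) :
    (G.cut h).numComponents ≤ G.numComponents + 1 := by
  refine numComponents_le_add_one rfl rfl (fun x => ?_) h fun x hx => cut_pair_off hx
  by_cases hx : G.OnEdge h x
  exacts [Or.inr (cut_pair_on hx), Or.inl (cut_pair_off hx)]

end RibbonGraph

namespace RibbonGraph

open Relation

variable {H : Type*}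

/-! ### The numbers of a spliced graph -/

section SpliceNumbers

variable [DecidableEq H] [Fintype H] {G K : RibbonGraph H} {h : H} {σ : H × Bool → H × Bool}
  {P : G.PairsCrosses h σ} {L : RibbonGraph (G.Rest h)}

omit [DecidableEq H] [Fintype H] in
theorem eq_iff_restCross (x y : G.Rest h × Bool) : x = y ↔ restCross x = restCross y :=
  restCross_injective.eq_iff.symm

omit [DecidableEq H] [Fintype H] in
theorem restCross_strand (hp : ∀ x, (L.pair x).1 = K.pair x.1) (x : G.Rest h × Bool) :
    restCross (L.strand x) = K.strand (restCross x) := Prod.ext (hp x.1) rfl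

omit [DecidableEq H] [Fintype H] in
theorem isFlag_rest_iff (hp : ∀ x, (L.pair x).1 = K.pair x.1) (x : G.Rest h) :
    L.IsFlag x ↔ K.IsFlag x.1 := by
  rw [IsFlag, IsFlag, Subtype.ext_iff, hp]

omit [DecidableEq H] [Fintype H] in
theorem boundaryJump_rest_iff (hp : ∀ x, (L.pair x).1 = K.pair x.1) (x y : G.Rest h × Bool) :
    L.BoundaryJump x y ↔ K.BoundaryJump (restCross x) (restCross y) := by
  rw [BoundaryJump, BoundaryJump, eq_iff_restCross y, eq_iff_restCross y, restCross_strand hp,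
    isFlag_rest_iff hp]
  rfl

/-- This and the following lemmas express the numbers of a spliced graph by crosses of `G`. The
pairing of `L` is left free because `L` will be a c-subgraph of the splice, with `K` the matching
c-subgraph of `G` in the lemmas involving edges. -/
theorem numVertices_splice (ha : L.arc = (G.splice h σ P).arc)
    (hi : L.isolated = (G.splice h σ P).isolated) :
    L.numVertices = classCount (G.SpliceStep h σ fun x y => y = flip x) + G.isolated := by
  rw [numVertices_eq, hi, ← classCount_splice P]
  congr 2
  ext x y
  rw [VertexStep, ha, eq_iff_restCross y (flip x)]
  rfl

theorem numComponents_splice (ha : L.arc = (G.splice h σ P).arc)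
    (hi : L.isolated = (G.splice h σ P).isolated) (hp : ∀ x, (L.pair x).1 = K.pair x.1) :
    L.numComponents =
      classCount (G.SpliceStep h σ fun x y => y = flip x ∨ y = K.strand x) + G.isolated := by
  rw [numComponents_eq, hi, ← classCount_splice P]
  congr 2
  ext x y
  rw [ComponentStep, ha, eq_iff_restCross y (flip x), eq_iff_restCross y (L.strand x),
    restCross_strand hp]
  rfl

omit [Fintype H] in
theorem boundaryStep_splice (ha : L.arc = (G.splice h σ P).arc)
    (hp : ∀ x, (L.pair x).1 = K.pair x.1) :
    L.BoundaryStep = fun x y => y = (G.splice h σ P).arc x ∨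
      K.BoundaryJump (restCross x) (restCross y) := by
  ext x y
  rw [BoundaryStep, ha, boundaryJump_rest_iff hp]

theorem numClosedFaces_splice (ha : L.arc = (G.splice h σ P).arc)
    (hi : L.isolated = (G.splice h σ P).isolated) (hp : ∀ x, (L.pair x).1 = K.pair x.1)
    (hK : ∀ x, G.OnEdge h x → ¬ K.IsFlag x) :
    L.numClosedFaces =
      freeCount (G.SpliceStep h σ K.BoundaryJump) (fun x => K.IsFlag x.1) + G.isolated := by
  rw [numClosedFaces_eq, hi, ← freeCount_splice P _ fun x hx ho => hK _ ho hx,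
    boundaryStep_splice ha hp]
  congr 2
  ext x
  exact isFlag_rest_iff hp x.1

/-- The sum is what a class count provides; `C_∂` is recovered once the closed faces have been
compared. -/
theorem numBoundaryComponents_splice (ha : L.arc = (G.splice h σ P).arc)
    (hi : L.isolated = (G.splice h σ P).isolated) (hp : ∀ x, (L.pair x).1 = K.pair x.1) :
    L.numBoundaryComponents + L.numClosedFaces =
      classCount (G.SpliceStep h σ K.BoundaryJump) + G.isolated := by
  rw [numClosedFaces_eq, hi, ← classCount_splice P, ← add_assoc, numBoundaryComponents_eq,
    boundaryStep_splice ha hp]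

omit [DecidableEq H] [Fintype H] in
theorem numFlags_rest (hp : ∀ x, (L.pair x).1 = K.pair x.1)
    (hK : ∀ x, G.OnEdge h x → ¬ K.IsFlag x) : L.numFlags = K.numFlags := by
  refine Nat.card_congr
    { toFun := fun x => ⟨x.1.1, (isFlag_rest_iff hp x.1).1 x.2⟩
      invFun := fun x => ⟨⟨x.1, fun e => hK _ (Or.inl e) x.2, fun e => hK _ (Or.inr e) x.2⟩,
        (isFlag_rest_iff hp _).2 x.2⟩
      left_inv := fun _ => rfl
      right_inv := fun _ => rfl }

omit [DecidableEq H] in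
theorem numBoundaryComponents_add_numClosedFaces (K : RibbonGraph H) :
    K.numBoundaryComponents + K.numClosedFaces = classCount K.BoundaryStep + K.isolated := by
  rw [numClosedFaces_eq, ← add_assoc, numBoundaryComponents_eq]

end SpliceNumbers

/-! ### Connections between the crosses of an edge -/

section Crosses

variable {G : RibbonGraph H} {h : H}

/-- From a cross of `e`, following arcs and a pairing of the crosses off `e`, one reaches another
cross of `e`. -/
theorem exists_cross [Finite H] {τ : H × Bool → H × Bool}
    (hτ : ∀ x, ¬ G.OnEdge h x.1 → τ (τ x) = x) (hτne : ∀ x, ¬ G.OnEdge h x.1 → τ x ≠ x)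
    (hτon : ∀ x, ¬ G.OnEdge h x.1 → ¬ G.OnEdge h (τ x).1) {x : H × Bool} (hx : G.OnEdge h x.1) :
    ∃ y, G.OnEdge h y.1 ∧ y ≠ x ∧
      EqvGen (fun x y => y = G.arc x ∨ (¬ G.OnEdge h x.1 ∧ y = τ x)) x y :=
  exists_ne_eqvGen (on := fun x : H × Bool => G.OnEdge h x.1) G.arc_arc G.arc_ne hτ hτne hτon hx

theorem flip_ne (x : H × Bool) : flip x ≠ x := by
  simp [flip, Prod.ext_iff]

theorem flip_flip (x : H × Bool) : flip (flip x) = x := by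
  simp [flip]

theorem isLoop_iff : G.IsLoop h ↔ EqvGen G.VertexStep (h, false) (G.pair h, false) :=
  Sum.inl_injective.eq_iff.trans quot_eq_iff

theorem eqvGen_vertexStep (x : H) (b c : Bool) : EqvGen G.VertexStep (x, b) (x, c) := by
  cases b <;> cases c
  exacts [.refl _, .rel _ _ (Or.inr rfl), .rel _ _ (Or.inr rfl), .refl _]

/-- The vertex circle through an end of an edge which is not a self-loop stays connected when the
segment of the edge is removed. -/
theorem eqvGen_flip_of_not_isLoop [Finite H] (hl : ¬ G.IsLoop h) {x : H × Bool}
    (hx : G.OnEdge h x.1) :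
    EqvGen (fun x y => y = G.arc x ∨ (¬ G.OnEdge h x.1 ∧ y = flip x)) x (flip x) := by
  -- Parity gives a second cross of `e` on this path. It cannot be at the other end, as then `e`
  -- would be a self-loop, so it is `flip x`.
  obtain ⟨y, hy, hne, hxy⟩ := exists_cross (G := G) (h := h) (τ := flip)
    (fun x _ => flip_flip x) (fun x _ => flip_ne x) (fun x hx => hx) hx
  have hv : EqvGen G.VertexStep x y := eqvGen_le (by
    rintro x y (h | h)
    exacts [.rel _ _ (Or.inl h), .rel _ _ (Or.inr h.2)]) hxy
  obtain ⟨x, b⟩ := x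
  obtain ⟨y, c⟩ := y
  by_cases hyx : y = x
  · subst hyx
    have : c = !b := by
      cases b <;> cases c <;> simp_all
    subst this
    exact hxy
  · exfalso
    apply hl
    have hv' : EqvGen G.VertexStep (x, false) (y, false) :=
      .trans _ _ _ (eqvGen_vertexStep x false b) (.trans _ _ _ hv (eqvGen_vertexStep y c false))
    rw [isLoop_iff]
    rcases hx with rfl | rfl <;> rcases hy with rfl | rfl
    · exact absurd rfl hyx
    · exact hv'
    · exact hv'.symm _ _
    · exact absurd rfl hyx

/-- If the two sides of a self-loop are not linked, then any pairing of the crosses off it which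
respects the links connects its crosses in the same two pairs. -/
theorem eqvGen_of_linkedOff [Finite H] (ht : ¬ G.LinkedOff h (h, false) (h, true)) {c : Bool}
    (hc : G.LinkedOff h (h, false) (G.pair h, c)) {τ : H × Bool → H × Bool}
    (hτ : ∀ x, ¬ G.OnEdge h x.1 → τ (τ x) = x) (hτne : ∀ x, ¬ G.OnEdge h x.1 → τ x ≠ x)
    (hτon : ∀ x, ¬ G.OnEdge h x.1 → ¬ G.OnEdge h (τ x).1)
    (hτl : ∀ x, ¬ G.OnEdge h x.1 → G.LinkedOff h x (τ x)) (b : Bool) :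
    EqvGen (fun x y => y = G.arc x ∨ (¬ G.OnEdge h x.1 ∧ y = τ x)) (h, b) (G.pair h, xor b c) := by
  have hle : ∀ {x y}, EqvGen (fun x y => y = G.arc x ∨ (¬ G.OnEdge h x.1 ∧ y = τ x)) x y →
      G.LinkedOff h x y := by
    refine fun h' => eqvGen_le ?_ h'
    rintro x y (h | ⟨h, rfl⟩)
    exacts [.rel _ _ (Or.inl h), hτl x h]
  have hsymm : ∀ {x y}, G.LinkedOff h x y → G.LinkedOff h y x := fun h => h.symm _ _
  have htrans : ∀ {x y z}, G.LinkedOff h x y → G.LinkedOff h y z → G.LinkedOff h x z :=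
    fun h h' => h.trans _ _ _ h'
  -- Parity leads from `(h, true)` to another cross of `e`. Both `(h, false)` and `(h', c)`, with
  -- `h'` the other half, are linked to `(h, false)` and hence excluded; `(h', !c)` remains.
  have h1 : EqvGen (fun x y => y = G.arc x ∨ (¬ G.OnEdge h x.1 ∧ y = τ x))
      (h, true) (G.pair h, !c) := by
    obtain ⟨⟨y, d⟩, hy | hy, hne, hxy⟩ := exists_cross hτ hτne hτon (x := (h, true)) (Or.inl rfl)
    · dsimp only at hy
      subst hy
      have : d = false := by cases d <;> simp_all
      subst this
      exact absurd (hsymm (hle hxy)) ht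
    · dsimp only at hy
      subst hy
      by_cases hd : d = c
      · subst hd
        exact absurd (htrans hc (hsymm (hle hxy))) ht
      · have : d = !c := by cases d <;> cases c <;> simp_all
        subst this
        exact hxy
  cases b with
  | true => simpa using h1
  | false =>
    obtain ⟨⟨y, d⟩, hy | hy, hne, hxy⟩ := exists_cross hτ hτne hτon (x := (h, false)) (Or.inl rfl)
    · dsimp only at hy
      subst hy
      have : d = true := by cases d <;> simp_all
      subst this
      exact absurd (hle hxy) ht
    · dsimp only at hy
      subst hy
      by_cases hd : d = c
      · subst hd
        simpa using hxy
      · have : d = !c := by cases d <;> cases c <;> simp_all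
        subst this
        exact absurd (htrans (hle hxy) (hsymm (hle h1))) ht

theorem linkedOff_of_sameSide {x y : H × Bool} (hxy : G.SameSide h x y) : G.LinkedOff h x y := by
  refine eqvGen_le ?_ hxy
  rintro x y (h | h)
  exacts [.rel _ _ (Or.inl h), .rel _ _ (Or.inr ⟨h.1, Or.inl h.2⟩)]

/-- By parity the side starting at `(h, false)` ends at another cross of the loop. Triviality
excludes `(h, true)`, and twistedness excludes the end carrying the same label. -/
theorem linkedOff_of_isTwistedLoop [Finite H] (ht : ¬ G.LinkedOff h (h, false) (h, true))
    (htw : G.IsTwistedLoop h) : G.LinkedOff h (h, false) (G.pair h, true) := by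
  obtain ⟨⟨y, c⟩, hy, hne, hxy⟩ := exists_cross (G := G) (h := h) (τ := flip)
    (fun x _ => flip_flip x) (fun x _ => flip_ne x) (fun x hx => hx) (x := (h, false)) (Or.inl rfl)
  have hl := linkedOff_of_sameSide hxy
  rcases hy with hy | hy <;> dsimp only at hy <;> subst hy <;> cases c
  · exact absurd rfl hne
  · exact absurd hl ht
  · exact absurd hxy htw.2
  · exact hl

end Crosses

end RibbonGraph

namespace RibbonGraph

open Relation

variable {H : Type*} [Fintype H] {G K : RibbonGraph H} {h : H}

/-! ### Comparison of the vertices -/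

section Vertices

omit [Fintype H] in
theorem spliceStep_flip_iff {ρ : H × Bool → H × Bool → Prop} {x y : H × Bool} :
    G.SpliceStep h flip (fun x y => y = flip x ∨ ρ x y) x y ↔
      y = G.arc x ∨ y = flip x ∨ (¬ G.OnEdge h x.1 ∧ ¬ G.OnEdge h y.1 ∧ ρ x y) := by
  constructor
  · rintro (h | h | ⟨hx, hy, h | h⟩)
    exacts [Or.inl h, Or.inr (Or.inl h.2), Or.inr (Or.inl h), Or.inr (Or.inr ⟨hx, hy, h⟩)]
  · rintro (h | rfl | h)
    · exact Or.inl h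
    · by_cases hx : G.OnEdge h x.1
      exacts [Or.inr (Or.inl ⟨hx, rfl⟩), Or.inr (Or.inr ⟨hx, hx, Or.inl rfl⟩)]
    · exact Or.inr (Or.inr ⟨h.1, h.2.1, Or.inr h.2.2⟩)

omit [Fintype H] in
theorem spliceStep_flip : G.SpliceStep h flip (fun x y => y = flip x) = G.VertexStep := by
  have e : (fun x y : H × Bool => y = flip x) = fun x y => y = flip x ∨ False := by simp
  ext x y
  rw [e, spliceStep_flip_iff, VertexStep]
  simp

/-- For an edge which is not a self-loop, the steps of a splice which follow the segments off `e`
connect the two crosses of each end of `e`. -/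
theorem eqvGen_spliceStep_flip (hl : ¬ G.IsLoop h) {σ : H × Bool → H × Bool}
    {ρ : H × Bool → H × Bool → Prop} (hρ : ∀ x, ρ x (flip x)) (x : H × Bool) :
    EqvGen (G.SpliceStep h σ ρ) x (flip x) := by
  by_cases hx : G.OnEdge h x.1
  · refine eqvGen_le ?_ (eqvGen_flip_of_not_isLoop hl hx)
    rintro x y (h | ⟨h, rfl⟩)
    exacts [.rel _ _ (Or.inl h), .rel _ _ (Or.inr (Or.inr ⟨h, h, hρ x⟩))]
  · exact .rel _ _ (Or.inr (Or.inr ⟨hx, hx, hρ x⟩))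

/-- At each end of `e` the segment can be bypassed around the rest of the vertex circle, so
replacing segments by strands loses no connection; the two strands then join the same two circles
and amount to one link. -/
theorem classCount_vertexStep_of_not_isLoop (hl : ¬ G.IsLoop h) :
    classCount G.VertexStep =
      classCount (G.SpliceStep h G.strand fun x y => y = flip x) + 1 := by
  refine classCount_add_pair (a := (h, false)) (b := (G.pair h, false)) ?_ ?_
    (.rel _ _ (Or.inr (Or.inl ⟨Or.inl rfl, rfl⟩))) fun h' => hl (isLoop_iff.2 h')
  · rintro x y (h | rfl)
    exacts [.rel _ _ (Or.inl h),
      eqvGen_spliceStep_flip (ρ := fun x y => y = flip x) hl (fun _ => rfl) x]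
  · have hpair : ∀ b, EqvGen (fun x y => G.VertexStep x y ∨
        (x = (h, false) ∧ y = (G.pair h, false))) (h, b) (G.pair h, b) := by
      have hle : ∀ {x y}, EqvGen G.VertexStep x y → EqvGen (fun x y => G.VertexStep x y ∨
        (x = (h, false) ∧ y = (G.pair h, false))) x y :=
        fun h' => eqvGen_le (fun x y h => .rel _ _ (Or.inl h)) h'
      exact fun b => .trans _ _ _ (hle (eqvGen_vertexStep h b false))
        (.trans _ _ _ (.rel _ _ (Or.inr ⟨rfl, rfl⟩)) (hle (eqvGen_vertexStep _ false b)))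
    rintro ⟨x, b⟩ y (h | ⟨rfl | rfl, rfl⟩ | ⟨-, -, h⟩)
    · exact .rel _ _ (Or.inl (Or.inl h))
    · exact hpair b
    · simp only [strand, G.pair_pair]
      exact (hpair b).symm _ _
    · exact .rel _ _ (Or.inl (Or.inr h))

/-- For a trivial untwisted self-loop, contraction separates the two sides. Here `ρ` consists of
steps along the segments and along some of the edges. -/
theorem classCount_spliceStep_strand_of_untwisted (ht : ¬ G.LinkedOff h (h, false) (h, true))
    (hu : G.LinkedOff h (h, false) (G.pair h, false)) {s : H × Bool → H × Bool → Prop}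
    {ρ : H × Bool → H × Bool → Prop} (hρ : ∀ x, ρ x (flip x))
    (hρl : ∀ x y, ¬ G.OnEdge h x.1 → ρ x y → G.LinkedOff h x y)
    (hrs : ∀ x y, G.SpliceStep h G.strand ρ x y → EqvGen s x y)
    (hsr : ∀ x y, s x y → y = flip x ∨ EqvGen (G.SpliceStep h G.strand ρ) x y)
    (hs : EqvGen s (h, false) (h, true)) :
    classCount (G.SpliceStep h G.strand ρ) = classCount s + 1 := by
  refine classCount_add_pair (a := (h, false)) (b := (h, true)) hrs ?_ hs fun h' => ht ?_
  · intro x y hxy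
    have hle : ∀ {x y}, EqvGen (G.SpliceStep h G.strand ρ) x y →
        EqvGen (fun x y => G.SpliceStep h G.strand ρ x y ∨ (x = (h, false) ∧ y = (h, true))) x y :=
      fun h' => eqvGen_le (fun x y h => .rel _ _ (Or.inl h)) h'
    have hh : ∀ b, EqvGen (fun x y => G.SpliceStep h G.strand ρ x y ∨
        (x = (h, false) ∧ y = (h, true))) (h, b) (h, !b) := by
      rintro (_ | _)
      exacts [.rel _ _ (Or.inr ⟨rfl, rfl⟩), EqvGen.symm _ _ (.rel _ _ (Or.inr ⟨rfl, rfl⟩))]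
    have hst : ∀ b, EqvGen (G.SpliceStep h G.strand ρ) (h, b) (G.pair h, b) :=
      fun b => .rel _ _ (Or.inr (Or.inl ⟨Or.inl rfl, rfl⟩))
    rcases hsr x y hxy with rfl | hxy
    · by_cases hx : G.OnEdge h x.1
      · obtain ⟨x, b⟩ := x
        rcases hx with rfl | rfl
        · exact hh b
        -- The segment at the second end follows from the first one by travelling along the two
        -- strands.
        · exact .trans _ _ _ ((hle (hst b)).symm _ _) (.trans _ _ _ (hh b) (hle (hst !b)))
      · exact hle (.rel _ _ (Or.inr (Or.inr ⟨hx, hx, hρ x⟩)))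
    · exact hle hxy
  · refine eqvGen_le ?_ h'
    -- Each strand joins crosses that are already linked off `e`, so following strands cannot lead
    -- from one side of the loop to the other.
    have hpair : ∀ b, G.LinkedOff h (h, b) (G.pair h, b) := by
      intro b
      have := eqvGen_of_linkedOff ht hu (τ := flip) (fun x _ => flip_flip x)
        (fun x _ => flip_ne x) (fun x hx => hx)
        (fun x hx => .rel _ _ (Or.inr ⟨hx, Or.inl rfl⟩)) b
      rw [Bool.xor_false] at this
      refine eqvGen_le ?_ this
      rintro x y (h | ⟨h, rfl⟩)
      exacts [.rel _ _ (Or.inl h), .rel _ _ (Or.inr ⟨h, Or.inl rfl⟩)]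
    rintro ⟨x, b⟩ y (h | ⟨rfl | rfl, rfl⟩ | ⟨hx, -, h⟩)
    · exact .rel _ _ (Or.inl h)
    · exact hpair b
    · simp only [strand, G.pair_pair]
      exact (hpair b).symm _ _
    · exact hρl _ _ hx h

theorem classCount_vertexStep_of_untwisted (ht : ¬ G.LinkedOff h (h, false) (h, true))
    (hu : G.LinkedOff h (h, false) (G.pair h, false)) (hl : G.IsLoop h) :
    classCount (G.SpliceStep h G.strand fun x y => y = flip x) = classCount G.VertexStep + 1 := by
  refine classCount_spliceStep_strand_of_untwisted ht hu (fun _ => rfl)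
    (fun x y hx h => .rel _ _ (Or.inr ⟨hx, Or.inl h⟩)) ?_ ?_ (.rel _ _ (Or.inr rfl))
  · have hpair : ∀ b, EqvGen G.VertexStep (h, b) (G.pair h, b) := fun b =>
      .trans _ _ _ (eqvGen_vertexStep h b false)
        (.trans _ _ _ (isLoop_iff.1 hl) (eqvGen_vertexStep _ false b))
    rintro ⟨x, b⟩ y (h | ⟨rfl | rfl, rfl⟩ | ⟨-, -, h⟩)
    · exact .rel _ _ (Or.inl h)
    · exact hpair b
    · simp only [strand, G.pair_pair]
      exact (hpair b).symm _ _
    · exact .rel _ _ (Or.inr h)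
  · rintro x y (h | h)
    exacts [Or.inr (.rel _ _ (Or.inl h)), Or.inl h]

end Vertices

/-! ### Comparison of the components -/

section Components

variable (ha : K.arc = G.arc) (hon : ∀ x, G.OnEdge h x → K.pair x = G.pair x)
  (hp : ∀ x, K.pair x = G.pair x ∨ K.pair x = x)

include ha hon

omit [Fintype H] in
theorem eqvGen_componentStep_of_spliceStep_strand {x y : H × Bool}
    (hxy : G.SpliceStep h G.strand (fun x y => y = flip x ∨ y = K.strand x) x y) :
    EqvGen K.ComponentStep x y := by
  rcases hxy with h | ⟨hx, rfl⟩ | ⟨-, -, h | h⟩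
  · exact .rel _ _ (Or.inl (ha ▸ h))
  · exact .rel _ _ (Or.inr (Or.inr (by rw [strand, strand, hon _ hx])))
  · exact .rel _ _ (Or.inr (Or.inl h))
  · exact .rel _ _ (Or.inr (Or.inr h))

include hp

omit [Fintype H] in
theorem eq_flip_or_eqvGen_of_componentStep {x y : H × Bool} (hxy : K.ComponentStep x y) :
    y = flip x ∨
      EqvGen (G.SpliceStep h G.strand (fun x y => y = flip x ∨ y = K.strand x)) x y := by
  rcases hxy with h | h | rfl
  · exact Or.inr (.rel _ _ (Or.inl (ha ▸ h)))
  · exact Or.inl h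
  · right
    by_cases hx : G.OnEdge h x.1
    · exact .rel _ _ (Or.inr (Or.inl ⟨hx, by rw [strand, strand, hon _ hx]⟩))
    · refine .rel _ _ (Or.inr (Or.inr ⟨hx, ?_, Or.inr rfl⟩))
      rcases hp x.1 with e | e
      · simpa only [strand, e, onEdge_pair_iff] using hx
      · simpa only [strand, e] using hx

theorem classCount_componentStep_of_not_isLoop (hl : ¬ G.IsLoop h) :
    classCount (G.SpliceStep h G.strand fun x y => y = flip x ∨ y = K.strand x) =
      classCount K.ComponentStep := by
  refine classCount_congr
    (fun x y hxy => eqvGen_componentStep_of_spliceStep_strand ha hon hxy) fun x y hxy => ?_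
  rcases eq_flip_or_eqvGen_of_componentStep ha hon hp hxy with rfl | h
  · exact eqvGen_spliceStep_flip hl (fun _ => Or.inl rfl) x
  · exact h

theorem classCount_componentStep_of_untwisted (ht : ¬ G.LinkedOff h (h, false) (h, true))
    (hu : G.LinkedOff h (h, false) (G.pair h, false)) :
    classCount (G.SpliceStep h G.strand fun x y => y = flip x ∨ y = K.strand x) =
      classCount K.ComponentStep + 1 := by
  refine classCount_spliceStep_strand_of_untwisted ht hu (fun _ => Or.inl rfl) ?_
    (fun x y hxy => eqvGen_componentStep_of_spliceStep_strand ha hon hxy)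
    (fun x y hxy => eq_flip_or_eqvGen_of_componentStep ha hon hp hxy)
    (.rel _ _ (Or.inr (Or.inl rfl)))
  rintro x y hx (h | rfl)
  · exact .rel _ _ (Or.inr ⟨hx, Or.inl h⟩)
  · rcases hp x.1 with e | e
    · exact .rel _ _ (Or.inr ⟨hx, Or.inr (by rw [strand, strand, e])⟩)
    · rw [strand, e]
      exact .refl _

-- Both ends of a self-loop lie on one vertex circle, so its strands are redundant for
-- connectedness.
omit [Fintype H] in
theorem classCount_componentStep_of_isLoop (hl : G.IsLoop h) :
    classCount (G.SpliceStep h flip fun x y => y = flip x ∨ y = K.strand x) =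
      classCount K.ComponentStep := by
  refine classCount_congr (fun x y hxy => ?_) fun x y hxy => ?_
  · rcases spliceStep_flip_iff.1 hxy with h | h | h
    · exact .rel _ _ (Or.inl (ha ▸ h))
    · exact .rel _ _ (Or.inr (Or.inl h))
    · exact .rel _ _ (Or.inr (Or.inr h.2.2))
  · have hv : ∀ {x y}, EqvGen G.VertexStep x y → EqvGen
        (G.SpliceStep h flip fun x y => y = flip x ∨ y = K.strand x) x y := by
      refine fun h' => eqvGen_le ?_ h'
      rintro x y (h | h)
      exacts [.rel _ _ (Or.inl h), .rel _ _ (spliceStep_flip_iff.2 (Or.inr (Or.inl h)))]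
    have hpair : ∀ b, EqvGen G.VertexStep (h, b) (G.pair h, b) := fun b =>
      .trans _ _ _ (eqvGen_vertexStep h b false)
        (.trans _ _ _ (isLoop_iff.1 hl) (eqvGen_vertexStep _ false b))
    rcases hxy with h | h | rfl
    · exact .rel _ _ (Or.inl (ha ▸ h))
    · exact .rel _ _ (spliceStep_flip_iff.2 (Or.inr (Or.inl h)))
    · by_cases hx : G.OnEdge h x.1
      · rw [strand, hon _ hx]
        obtain ⟨x, b⟩ := x
        rcases hx with rfl | rfl
        · exact hv (hpair b)
        · simp only [G.pair_pair]
          exact hv ((hpair b).symm _ _)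
      · refine .rel _ _ (spliceStep_flip_iff.2 (Or.inr (Or.inr ⟨hx, ?_, rfl⟩)))
        rcases hp x.1 with e | e
        · simpa only [strand, e, onEdge_pair_iff] using hx
        · simpa only [strand, e] using hx

end Components

/-- Deleting the ribbon of `e` has the same effect on the components as cutting it. -/
theorem numComponents_delete [DecidableEq H] (G : RibbonGraph H) (h : H) (hh : G.pair h ≠ h) :
    (G.delete h hh).numComponents = (G.cut h).numComponents := by
  rw [numComponents_splice (L := G.delete h hh) (K := G) (P := pairsCrosses_flip hh) rfl rfl (fun _ => rfl),
    numComponents_eq]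
  congr 1
  refine classCount_congr (fun x y hxy => ?_) fun x y hxy => ?_
  · rcases spliceStep_flip_iff.1 hxy with h | h | ⟨hx, -, rfl⟩
    · exact .rel _ _ (Or.inl h)
    · exact .rel _ _ (Or.inr (Or.inl h))
    · exact .rel _ _ (Or.inr (Or.inr (by rw [strand, strand, cut_pair_off hx])))
  · rcases hxy with h | h | rfl
    · exact .rel _ _ (Or.inl h)
    · exact .rel _ _ (spliceStep_flip_iff.2 (Or.inr (Or.inl h)))
    · by_cases hx : G.OnEdge h x.1
      · rw [strand, cut_pair_on hx]
        exact .refl _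
      · rw [strand, cut_pair_off hx]
        exact .rel _ _ (spliceStep_flip_iff.2 (Or.inr (Or.inr ⟨hx, onEdge_pair_iff.not.2 hx, rfl⟩)))

theorem numComponents_cut_of_isLoop [DecidableEq H] (hh : G.pair h ≠ h) (hl : G.IsLoop h) :
    (G.cut h).numComponents = G.numComponents := by
  rw [← numComponents_delete G h hh,
    numComponents_splice (L := G.delete h hh) (K := G) (P := pairsCrosses_flip hh) rfl rfl (fun _ => rfl),
    numComponents_eq, classCount_componentStep_of_isLoop rfl (fun _ _ => rfl)
      (fun _ => Or.inl rfl) hl]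

/-! ### Comparison of the faces -/

section Faces

variable (ha : K.arc = G.arc) (hon : ∀ x, G.OnEdge h x → K.pair x = G.pair x)
  (hp : ∀ x, K.pair x = G.pair x ∨ K.pair x = x)

include hp in
omit [Fintype H] in
theorem onEdge_of_boundaryJump {x y : H × Bool} (hx : ¬ G.OnEdge h x.1)
    (hxy : K.BoundaryJump x y) : ¬ G.OnEdge h y.1 := by
  rcases hxy with rfl | ⟨-, rfl⟩
  · rcases hp x.1 with e | e
    · simpa only [strand, e, onEdge_pair_iff] using hx
    · simpa only [strand, e] using hx
  · exact hx

include hon in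
omit [Fintype H] in
theorem not_isFlag_of_onEdge (hh : G.pair h ≠ h) {x : H} (hx : G.OnEdge h x) : ¬ K.IsFlag x := by
  rw [IsFlag, hon x hx]
  rcases hx with rfl | rfl
  · exact hh
  · rw [G.pair_pair]
    exact hh.symm

include ha hon hp

-- As `e` is kept in `K`, it carries no flag and boundary curves pass it along its strands, just as
-- contraction joins its crosses.
omit [Fintype H] in
theorem boundaryStep_iff (hh : G.pair h ≠ h) {x y : H × Bool} :
    K.BoundaryStep x y ↔ G.SpliceStep h G.strand K.BoundaryJump x y := by
  rw [BoundaryStep, SpliceStep, ha]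
  refine or_congr_right ⟨fun hxy => ?_, ?_⟩
  · by_cases hx : G.OnEdge h x.1
    · rcases hxy with rfl | ⟨hf, -⟩
      · exact Or.inl ⟨hx, by rw [strand, strand, hon _ hx]⟩
      · exact absurd hf (not_isFlag_of_onEdge hon hh hx)
    · exact Or.inr ⟨hx, onEdge_of_boundaryJump hp hx hxy, hxy⟩
  · rintro (⟨hx, rfl⟩ | ⟨-, -, hxy⟩)
    · exact Or.inl (by rw [strand, strand, hon _ hx])
    · exact hxy

omit [Fintype H] in
theorem boundaryStep_eq (hh : G.pair h ≠ h) :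
    K.BoundaryStep = G.SpliceStep h G.strand K.BoundaryJump := by
  ext x y
  exact boundaryStep_iff ha hon hp hh

/-- For a trivial twisted self-loop, the strands of `e` and the segments of `e` connect the four
crosses of `e` in the same way along the boundary. -/
theorem freeCount_boundaryStep_of_twisted (hh : G.pair h ≠ h)
    (ht : ¬ G.LinkedOff h (h, false) (h, true))
    (htw : G.LinkedOff h (h, false) (G.pair h, true)) (p : H × Bool → Prop) :
    freeCount (G.SpliceStep h flip K.BoundaryJump) p = freeCount K.BoundaryStep p := by
  classical
  rw [boundaryStep_eq ha hon hp hh]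
  -- Jumping across flags makes the boundary jump an involution without fixed points, as the parity
  -- argument requires.
  let τ : H × Bool → H × Bool := fun x => if K.IsFlag x.1 then flip x else K.strand x
  have hτjump : ∀ x, K.BoundaryJump x (τ x) := by
    intro x
    by_cases hx : K.IsFlag x.1
    · exact Or.inr ⟨hx, if_pos hx⟩
    · exact Or.inl (if_neg hx)
  have hτon : ∀ x, ¬ G.OnEdge h x.1 → ¬ G.OnEdge h (τ x).1 := fun x hx =>
    onEdge_of_boundaryJump hp hx (hτjump x)
  have hττ : ∀ x, ¬ G.OnEdge h x.1 → τ (τ x) = x := by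
    intro x _
    by_cases hx : K.IsFlag x.1
    · have hx' : K.IsFlag (flip x).1 := hx
      simp only [τ, if_pos hx, if_pos hx', flip_flip]
    · have hx' : ¬ K.IsFlag (K.strand x).1 := by
        intro h'
        rw [IsFlag, strand, K.pair_pair] at h'
        exact hx h'.symm
      simp only [τ, if_neg hx, if_neg hx']
      simp [strand, K.pair_pair]
  have hτne : ∀ x, ¬ G.OnEdge h x.1 → τ x ≠ x := by
    intro x _
    by_cases hx : K.IsFlag x.1
    · simpa only [τ, if_pos hx] using flip_ne x
    · simp only [τ, if_neg hx]
      exact fun e => hx (congrArg Prod.fst e)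
  have hτl : ∀ x, ¬ G.OnEdge h x.1 → G.LinkedOff h x (τ x) := by
    intro x hx
    by_cases hf : K.IsFlag x.1
    · simp only [τ, if_pos hf]
      exact .rel _ _ (Or.inr ⟨hx, Or.inl rfl⟩)
    · simp only [τ, if_neg hf]
      rcases hp x.1 with e | e
      · exact .rel _ _ (Or.inr ⟨hx, Or.inr (by rw [strand, strand, e])⟩)
      · exact absurd e hf
  -- Off `e` the boundary connects crosses of opposite labels at opposite ends. Combined with either
  -- the strands or the segments of `e`, this puts all four crosses into one class, so the two
  -- relations agree.
  have hW : ∀ (σ : H × Bool → H × Bool) b,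
      EqvGen (G.SpliceStep h σ K.BoundaryJump) (h, b) (G.pair h, !b) := by
    intro σ b
    have := eqvGen_of_linkedOff ht htw hττ hτne hτon hτl b
    rw [Bool.xor_true] at this
    refine eqvGen_le ?_ this
    rintro x y (h | ⟨h, rfl⟩)
    exacts [.rel _ _ (Or.inl h), .rel _ _ (Or.inr (Or.inr ⟨h, hτon x h, hτjump x⟩))]
  refine freeCount_congr p ?_ ?_
  · have hst : ∀ b, EqvGen (G.SpliceStep h G.strand K.BoundaryJump) (h, b) (G.pair h, b) :=
      fun b => .rel _ _ (Or.inr (Or.inl ⟨Or.inl rfl, rfl⟩))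
    rintro ⟨x, b⟩ y (h | ⟨rfl | rfl, rfl⟩ | h)
    · exact .rel _ _ (Or.inl h)
    · refine .trans _ _ _ (hW _ b) ((hst !b).symm _ _)
    · refine .trans _ _ _ ((hst b).symm _ _) (hW _ b)
    · exact .rel _ _ (Or.inr (Or.inr h))
  · have hfl : ∀ b, EqvGen (G.SpliceStep h flip K.BoundaryJump) (h, b) (G.pair h, b) := fun b =>
      .trans _ _ _ (.rel _ _ (Or.inr (Or.inl ⟨Or.inl rfl, rfl⟩)))
        (by simpa [flip] using hW flip (!b))
    rintro ⟨x, b⟩ y (h | ⟨rfl | rfl, rfl⟩ | h)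
    · exact .rel _ _ (Or.inl h)
    · exact hfl b
    · simp only [strand, G.pair_pair]
      exact (hfl b).symm _ _
    · exact .rel _ _ (Or.inr (Or.inr h))

/-- If a strand of `e` closes immediately, the deletion of `e` joins the closed face along this
strand to the boundary curve along the other one. -/
theorem freeCount_boundaryStep_of_hasInnerFace (hh : G.pair h ≠ h) (hf : G.HasInnerFace h)
    {p : H × Bool → Prop} (hpon : ∀ x, G.OnEdge h x.1 → ¬ p x) :
    freeCount K.BoundaryStep p = freeCount (G.SpliceStep h flip K.BoundaryJump) p + 1 := by
  rw [boundaryStep_eq ha hon hp hh]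
  obtain ⟨b, hb⟩ := hf
  have hb' : G.arc (G.pair h, b) = (h, b) := by rw [← hb, G.arc_arc]
  -- At label `b`, arc and strand join the same two crosses, so these form a closed face on their
  -- own. Using segments instead of strands joins it to the curve through `(h, !b)`.
  have hclass : ∀ x, EqvGen (G.SpliceStep h G.strand K.BoundaryJump) (h, b) x →
      x = (h, b) ∨ x = (G.pair h, b) := by
    intro x hx
    refine (eqvGen_closed (S := fun x => x = (h, b) ∨ x = (G.pair h, b)) ?_ hx).1 (Or.inl rfl)
    rintro x y (rfl | ⟨-, rfl⟩ | ⟨hx, hy, -⟩)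
    · constructor
      · rintro (rfl | rfl)
        exacts [Or.inr hb, Or.inl hb']
      · rintro (e | e)
        · exact Or.inr (arc_inj (e.trans hb'.symm))
        · exact Or.inl (arc_inj (e.trans hb.symm))
    · constructor
      · rintro (rfl | rfl)
        exacts [Or.inr rfl, Or.inl (by simp [strand, G.pair_pair])]
      · have hxx : x = G.strand (G.strand x) := by simp [strand, G.pair_pair]
        rintro (e | e) <;> rw [hxx, e]
        exacts [Or.inr rfl, Or.inl (by simp [strand, G.pair_pair])]
    · constructor
      · rintro (rfl | rfl)
        exacts [absurd (Or.inl rfl) hx, absurd (Or.inr rfl) hx]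
      · rintro (rfl | rfl)
        exacts [absurd (Or.inl rfl) hy, absurd (Or.inr rfl) hy]
  refine freeCount_add_pair (a := (h, b)) (b := (h, !b)) ?_ ?_
    (.rel _ _ (Or.inr (Or.inl ⟨Or.inl rfl, rfl⟩))) ?_ ?_
  · have hfl : ∀ c, EqvGen (G.SpliceStep h flip K.BoundaryJump) (h, c) (G.pair h, c) := by
      have h1 : EqvGen (G.SpliceStep h flip K.BoundaryJump) (h, b) (G.pair h, b) :=
        .rel _ _ (Or.inl hb.symm)
      intro c
      by_cases hc : c = b
      · subst hc
        exact h1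
      · have hc' : c = !b := by cases b <;> cases c <;> simp_all
        subst hc'
        -- The outer strand is replaced by a segment, the inner arc and the other segment.
        exact .trans _ _ _ ((EqvGen.rel (h, b) _ (Or.inr (Or.inl ⟨Or.inl rfl, rfl⟩))).symm _ _)
          (.trans _ _ _ h1 (.rel _ _ (Or.inr (Or.inl ⟨Or.inr rfl, rfl⟩))))
    rintro ⟨x, c⟩ y (h | ⟨rfl | rfl, rfl⟩ | h)
    · exact .rel _ _ (Or.inl h)
    · exact hfl c
    · simp only [strand, G.pair_pair]
      exact (hfl c).symm _ _
    · exact .rel _ _ (Or.inr (Or.inr h))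
  · have hst : ∀ c, EqvGen (fun x y => G.SpliceStep h G.strand K.BoundaryJump x y ∨
        (x = (h, b) ∧ y = (h, !b))) (h, c) (G.pair h, c) :=
      fun c => .rel _ _ (Or.inl (Or.inr (Or.inl ⟨Or.inl rfl, rfl⟩)))
    have hfl : ∀ c, EqvGen (fun x y => G.SpliceStep h G.strand K.BoundaryJump x y ∨
        (x = (h, b) ∧ y = (h, !b))) (h, c) (h, !c) := by
      intro c
      by_cases hc : c = b
      · subst hc
        exact .rel _ _ (Or.inr ⟨rfl, rfl⟩)
      · have hc' : c = !b := by cases b <;> cases c <;> simp_all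
        subst hc'
        rw [Bool.not_not]
        exact EqvGen.symm _ _ (.rel _ _ (Or.inr ⟨rfl, rfl⟩))
    rintro ⟨x, c⟩ y (h | ⟨rfl | rfl, rfl⟩ | h)
    · exact .rel _ _ (Or.inl (Or.inl h))
    · exact hfl c
    · exact .trans _ _ _ ((hst c).symm _ _) (.trans _ _ _ (hfl c) (hst !c))
    · exact .rel _ _ (Or.inl (Or.inr (Or.inr h)))
  · intro h'
    rcases hclass _ h' with e | e
    · simp at e
    · simp at e
  · intro x hx
    rcases hclass x hx with rfl | rfl
    exacts [hpon _ (Or.inl rfl), hpon _ (Or.inr rfl)]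

end Faces

end RibbonGraph

namespace RibbonGraph

open Relation

variable {H : Type*} [Fintype H] [DecidableEq H] {G : RibbonGraph H} {h : H}

/-! ### The recursion -/

theorem insert_liftEdges_subset (hh : G.pair h ≠ h) {K : RibbonGraph (G.Rest h)}
    (hK : ∀ x, (K.pair x).1 = G.pair x.1) {A : Finset (Sym2 (G.Rest h))} (hA : A ⊆ K.edges) :
    insert s(h, G.pair h) (liftEdges A) ⊆ G.edges := by
  rw [edges_eq_insert hh, ← liftEdges_edges hK]
  exact Finset.insert_subset_insert _ (Finset.image_subset_image hA)

/-- The terms of the edge sets without `e`, if `e` is not a bridge. -/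
theorem brTerm_cut_of_eq (hk : (G.cut h).numComponents = G.numComponents)
    {B : Finset (Sym2 H)} (hB : B ⊆ (G.cut h).edges) :
    G.brTerm B = 1 * (G.cut h).brTerm B := by
  have hr : (G.cut h).rank = G.rank := by
    unfold rank
    rw [hk]
    rfl
  rw [brTerm_eq G (G.cut h) B B 0 0 0 (by rw [sub_cut hB, hr, zero_add])
    (by rw [sub_cut hB, zero_add]) (by rw [sub_cut hB, zero_add]) (by rw [sub_cut hB])
    (by rw [sub_cut hB])]
  simp

/-- The terms of the edge sets without `e`, if `e` is a bridge. -/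
theorem brTerm_cut_of_isBridge (hk : (G.cut h).numComponents = G.numComponents + 1)
    {B : Finset (Sym2 H)} (hB : B ⊆ (G.cut h).edges) :
    G.brTerm B = LaurentPolynomial.C (MvPolynomial.X 0 - 1) * (G.cut h).brTerm B := by
  -- The c-subgraph is unchanged while `r(G ∨ e) = r(G) - 1`. The bounds `h1` and `h2` ensure that
  -- no difference of ranks is truncated.
  have h1 : (G.cut h).numComponents ≤ (G.sub B).numComponents := by
    rw [← sub_cut hB]
    exact numComponents_le_of_pair rfl rfl fun x => sub_pair_eq_or _ _ x
  have h2 : (G.sub B).numComponents ≤ (G.sub B).numVertices := numComponents_le_numVertices _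
  have h3 : (G.sub B).numVertices = G.numVertices := rfl
  have h4 : (G.cut h).numVertices = G.numVertices := rfl
  rw [brTerm_eq G (G.cut h) B B 1 0 0 ?_ (by rw [sub_cut hB, zero_add])
    (by rw [sub_cut hB, zero_add]) (by rw [sub_cut hB]) (by rw [sub_cut hB])]
  · simp
  · rw [sub_cut hB]
    unfold rank
    omega

/-- The terms of the edge sets containing `e`, if `e` is not a self-loop. -/
theorem brTerm_insert_of_not_isLoop (hh : G.pair h ≠ h) (hl : ¬ G.IsLoop h)
    {A : Finset (Sym2 (G.Rest h))} (hA : A ⊆ (G.contract h hh).edges) :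
    G.brTerm (insert s(h, G.pair h) (liftEdges A)) = 1 * (G.contract h hh).brTerm A := by
  set B := insert s(h, G.pair h) (liftEdges A) with hB
  have hBe : B ⊆ G.edges := insert_liftEdges_subset hh (K := G.contract h hh) (fun _ => rfl) hA
  have hcard : B.card = A.card + 1 := by
    rw [hB, Finset.card_insert_of_notMem (not_mem_liftEdges A), card_liftEdges]
  have harc : (G.sub B).arc = G.arc := rfl
  have hon : ∀ x, G.OnEdge h x → (G.sub B).pair x = G.pair x := fun x => sub_insert_pair_on G _
  have hor : ∀ x, (G.sub B).pair x = G.pair x ∨ (G.sub B).pair x = x := sub_pair_eq_or G B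
  have hp : ∀ x, (((G.contract h hh).sub A).pair x).1 = (G.sub B).pair x.1 :=
    sub_liftEdges_pair (K := G.contract h hh) (fun _ => rfl) A
  have hflag : ∀ x, G.OnEdge h x → ¬ (G.sub B).IsFlag x := fun x => not_isFlag_of_onEdge hon hh
  -- One vertex and one edge disappear and the components remain: the nullity is unchanged, and the
  -- ranks of the graph and of the c-subgraph both drop by one.
  have hV : G.numVertices = (G.contract h hh).numVertices + 1 := by
    rw [numVertices_splice (L := G.contract h hh) (P := pairsCrosses_strand hh) rfl rfl,
      numVertices_eq, classCount_vertexStep_of_not_isLoop hl, add_right_comm]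
  have hkG : (G.contract h hh).numComponents = G.numComponents := by
    rw [numComponents_splice (L := G.contract h hh) (K := G) (P := pairsCrosses_strand hh) rfl rfl
      (fun _ => rfl), numComponents_eq,
      classCount_componentStep_of_not_isLoop rfl (fun _ _ => rfl) (fun _ => Or.inl rfl) hl]
  have hk : ((G.contract h hh).sub A).numComponents = (G.sub B).numComponents := by
    rw [numComponents_splice (L := (G.contract h hh).sub A) (K := G.sub B) (P := pairsCrosses_strand hh)
      rfl rfl hp, numComponents_eq,
      classCount_componentStep_of_not_isLoop harc hon hor hl]
    rfl
  have hF : ((G.contract h hh).sub A).numClosedFaces = (G.sub B).numClosedFaces := by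
    rw [numClosedFaces_splice (L := (G.contract h hh).sub A) (K := G.sub B) (P := pairsCrosses_strand hh)
      rfl rfl hp hflag, numClosedFaces_eq,
      boundaryStep_eq harc hon hor hh]
    rfl
  have hC : ((G.contract h hh).sub A).numBoundaryComponents =
      (G.sub B).numBoundaryComponents := by
    have h1 := numBoundaryComponents_splice (P := pairsCrosses_strand hh)
      (L := (G.contract h hh).sub A) rfl rfl hp
    have h2 := numBoundaryComponents_add_numClosedFaces (G.sub B)
    rw [boundaryStep_eq harc hon hor hh] at h2
    have h3 : (G.sub B).isolated = G.isolated := rfl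
    omega
  have hf : ((G.contract h hh).sub A).numFlags = (G.sub B).numFlags := numFlags_rest hp hflag
  have hn : (G.sub B).nullity = ((G.contract h hh).sub A).nullity := by
    rw [nullity_sub hBe, nullity_sub hA]
    omega
  have hle : G.numComponents ≤ (G.sub B).numComponents := numComponents_le_of_pair rfl rfl hor
  have hle' := numComponents_le_numVertices ((G.contract h hh).sub A)
  have e1 : (G.sub B).numVertices = G.numVertices := rfl
  have e2 : ((G.contract h hh).sub A).numVertices = (G.contract h hh).numVertices := rfl
  rw [brTerm_eq G (G.contract h hh) B A 0 0 0 ?_ (by rw [hn, zero_add])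
    (by rw [hn, hk, hF, zero_add]) hC.symm hf.symm]
  · simp
  · unfold rank
    omega

/-- The terms of the edge sets containing `e`, if `e` is a trivial untwisted self-loop. -/
theorem brTerm_insert_of_untwisted (hh : G.pair h ≠ h)
    (ht : ¬ G.LinkedOff h (h, false) (h, true)) (hu : G.IsUntwistedLoop h)
    {A : Finset (Sym2 (G.Rest h))} (hA : A ⊆ (G.contract h hh).edges) :
    G.brTerm (insert s(h, G.pair h) (liftEdges A)) =
      LaurentPolynomial.C (MvPolynomial.X 1 - 1) * (G.contract h hh).brTerm A := by
  set B := insert s(h, G.pair h) (liftEdges A) with hB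
  have hu' := linkedOff_of_sameSide hu.2
  have hBe : B ⊆ G.edges := insert_liftEdges_subset hh (K := G.contract h hh) (fun _ => rfl) hA
  have hcard : B.card = A.card + 1 := by
    rw [hB, Finset.card_insert_of_notMem (not_mem_liftEdges A), card_liftEdges]
  have harc : (G.sub B).arc = G.arc := rfl
  have hon : ∀ x, G.OnEdge h x → (G.sub B).pair x = G.pair x := fun x => sub_insert_pair_on G _
  have hor : ∀ x, (G.sub B).pair x = G.pair x ∨ (G.sub B).pair x = x := sub_pair_eq_or G B
  have hp : ∀ x, (((G.contract h hh).sub A).pair x).1 = (G.sub B).pair x.1 :=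
    sub_liftEdges_pair (K := G.contract h hh) (fun _ => rfl) A
  have hflag : ∀ x, G.OnEdge h x → ¬ (G.sub B).IsFlag x := fun x => not_isFlag_of_onEdge hon hh
  -- Vertices and components both increase by one, so the ranks agree. The nullity drops by one with
  -- the lost edge, which cancels the increase of `k` in the exponent of `z`.
  have hV : (G.contract h hh).numVertices = G.numVertices + 1 := by
    rw [numVertices_splice (L := G.contract h hh) (P := pairsCrosses_strand hh) rfl rfl,
      numVertices_eq, classCount_vertexStep_of_untwisted ht hu' hu.1, add_right_comm]
  have hkG : (G.contract h hh).numComponents = G.numComponents + 1 := by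
    rw [numComponents_splice (L := G.contract h hh) (K := G) (P := pairsCrosses_strand hh) rfl rfl
      (fun _ => rfl), numComponents_eq, classCount_componentStep_of_untwisted rfl (fun _ _ => rfl)
      (fun _ => Or.inl rfl) ht hu', add_right_comm]
  have hk : ((G.contract h hh).sub A).numComponents = (G.sub B).numComponents + 1 := by
    rw [numComponents_splice (L := (G.contract h hh).sub A) (K := G.sub B) (P := pairsCrosses_strand hh)
      rfl rfl hp, numComponents_eq,
      classCount_componentStep_of_untwisted harc hon hor ht hu', add_right_comm]
    rfl
  have hF : ((G.contract h hh).sub A).numClosedFaces = (G.sub B).numClosedFaces := by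
    rw [numClosedFaces_splice (L := (G.contract h hh).sub A) (K := G.sub B) (P := pairsCrosses_strand hh)
      rfl rfl hp hflag, numClosedFaces_eq,
      boundaryStep_eq harc hon hor hh]
    rfl
  have hC : ((G.contract h hh).sub A).numBoundaryComponents =
      (G.sub B).numBoundaryComponents := by
    have h1 := numBoundaryComponents_splice (P := pairsCrosses_strand hh)
      (L := (G.contract h hh).sub A) rfl rfl hp
    have h2 := numBoundaryComponents_add_numClosedFaces (G.sub B)
    rw [boundaryStep_eq harc hon hor hh] at h2
    have h3 : (G.sub B).isolated = G.isolated := rfl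
    omega
  have hf : ((G.contract h hh).sub A).numFlags = (G.sub B).numFlags := numFlags_rest hp hflag
  have hnn := numVertices_le_card_add (G.contract h hh) hA
  have hn : (G.sub B).nullity = 1 + ((G.contract h hh).sub A).nullity := by
    rw [nullity_sub hBe, nullity_sub hA]
    omega
  have e1 : (G.sub B).numVertices = G.numVertices := rfl
  have e2 : ((G.contract h hh).sub A).numVertices = (G.contract h hh).numVertices := rfl
  rw [brTerm_eq G (G.contract h hh) B A 0 1 0 ?_ hn ?_ hC.symm hf.symm]
  · simp
  · unfold rank
    omega
  · rw [hn, hk, hF]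
    push_cast
    ring

/-- The terms of the edge sets containing `e`, if `e` is a trivial twisted self-loop. -/
theorem brTerm_insert_of_twisted (hh : G.pair h ≠ h)
    (ht : ¬ G.LinkedOff h (h, false) (h, true)) (htw : G.IsTwistedLoop h)
    {A : Finset (Sym2 (G.Rest h))} (hA : A ⊆ (G.delete h hh).edges) :
    G.brTerm (insert s(h, G.pair h) (liftEdges A)) =
      LaurentPolynomial.C (MvPolynomial.X 1 - 1) * LaurentPolynomial.T 1 *
        (G.delete h hh).brTerm A := by
  set B := insert s(h, G.pair h) (liftEdges A) with hB
  have htw' := linkedOff_of_isTwistedLoop ht htw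
  have hBe : B ⊆ G.edges := insert_liftEdges_subset hh (K := G.delete h hh) (fun _ => rfl) hA
  have hcard : B.card = A.card + 1 := by
    rw [hB, Finset.card_insert_of_notMem (not_mem_liftEdges A), card_liftEdges]
  have harc : (G.sub B).arc = G.arc := rfl
  have hon : ∀ x, G.OnEdge h x → (G.sub B).pair x = G.pair x := fun x => sub_insert_pair_on G _
  have hor : ∀ x, (G.sub B).pair x = G.pair x ∨ (G.sub B).pair x = x := sub_pair_eq_or G B
  have hp : ∀ x, (((G.delete h hh).sub A).pair x).1 = (G.sub B).pair x.1 :=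
    sub_liftEdges_pair (K := G.delete h hh) (fun _ => rfl) A
  have hflag : ∀ x, G.OnEdge h x → ¬ (G.sub B).IsFlag x := fun x => not_isFlag_of_onEdge hon hh
  -- Vertices, components and closed faces are all unchanged, so the lost edge costs one factor `y -
  -- 1` and one factor `z`.
  have hV : (G.delete h hh).numVertices = G.numVertices := by
    rw [numVertices_splice (L := G.delete h hh) (P := pairsCrosses_flip hh) rfl rfl,
      numVertices_eq, spliceStep_flip]
  have hkG : (G.delete h hh).numComponents = G.numComponents := by
    rw [numComponents_delete, numComponents_cut_of_isLoop hh htw.1]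
  have hk : ((G.delete h hh).sub A).numComponents = (G.sub B).numComponents := by
    rw [numComponents_splice (L := (G.delete h hh).sub A) (K := G.sub B) (P := pairsCrosses_flip hh)
      rfl rfl hp, numComponents_eq,
      classCount_componentStep_of_isLoop harc hon hor htw.1]
    rfl
  have hF : ((G.delete h hh).sub A).numClosedFaces = (G.sub B).numClosedFaces := by
    rw [numClosedFaces_splice (L := (G.delete h hh).sub A) (K := G.sub B) (P := pairsCrosses_flip hh)
      rfl rfl hp hflag, numClosedFaces_eq,
      freeCount_boundaryStep_of_twisted harc hon hor hh ht htw']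
    rfl
  have hC : ((G.delete h hh).sub A).numBoundaryComponents =
      (G.sub B).numBoundaryComponents := by
    have h1 := numBoundaryComponents_splice (P := pairsCrosses_flip hh)
      (L := (G.delete h hh).sub A) rfl rfl hp
    have h2 := numBoundaryComponents_add_numClosedFaces (G.sub B)
    rw [← freeCount_false, ← freeCount_boundaryStep_of_twisted harc hon hor hh ht htw',
      freeCount_false] at h2
    have h3 : (G.sub B).isolated = G.isolated := rfl
    omega
  have hf : ((G.delete h hh).sub A).numFlags = (G.sub B).numFlags := numFlags_rest hp hflag
  have hnn := numVertices_le_card_add (G.delete h hh) hA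
  have hn : (G.sub B).nullity = 1 + ((G.delete h hh).sub A).nullity := by
    rw [nullity_sub hBe, nullity_sub hA]
    omega
  have e1 : (G.sub B).numVertices = G.numVertices := rfl
  have e2 : ((G.delete h hh).sub A).numVertices = (G.delete h hh).numVertices := rfl
  rw [brTerm_eq G (G.delete h hh) B A 0 1 1 ?_ hn ?_ hC.symm hf.symm]
  · simp
  · unfold rank
    omega
  · rw [hn, hk, hF]
    push_cast
    ring

/-! ### Self-loops with an empty side -/

omit [DecidableEq H] in
theorem numVertices_addVertex (K : RibbonGraph H) :
    K.addVertex.numVertices = K.numVertices + 1 := by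
  rw [numVertices_eq, numVertices_eq, add_assoc]
  rfl

omit [DecidableEq H] in
theorem numComponents_addVertex (K : RibbonGraph H) :
    K.addVertex.numComponents = K.numComponents + 1 := by
  rw [numComponents_eq, numComponents_eq, add_assoc]
  rfl

omit [DecidableEq H] in
theorem numClosedFaces_addVertex (K : RibbonGraph H) :
    K.addVertex.numClosedFaces = K.numClosedFaces + 1 := by
  rw [numClosedFaces_eq, numClosedFaces_eq, add_assoc]
  rfl

/-- The terms of the edge sets containing `e`, if `e` is a self-loop with an empty side. -/
theorem brTerm_insert_of_hasInnerFace (hh : G.pair h ≠ h) (hl : G.IsLoop h)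
    (hi : G.HasInnerFace h) {A : Finset (Sym2 (G.Rest h))}
    (hA : A ⊆ (G.delete h hh).addVertex.edges) :
    G.brTerm (insert s(h, G.pair h) (liftEdges A)) =
      LaurentPolynomial.C (MvPolynomial.X 1 - 1) * (G.delete h hh).addVertex.brTerm A := by
  set B := insert s(h, G.pair h) (liftEdges A) with hB
  have hBe : B ⊆ G.edges :=
    insert_liftEdges_subset hh (K := G.delete h hh) (fun _ => rfl) hA
  have hcard : B.card = A.card + 1 := by
    rw [hB, Finset.card_insert_of_notMem (not_mem_liftEdges A), card_liftEdges]
  have harc : (G.sub B).arc = G.arc := rfl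
  have hon : ∀ x, G.OnEdge h x → (G.sub B).pair x = G.pair x := fun x => sub_insert_pair_on G _
  have hor : ∀ x, (G.sub B).pair x = G.pair x ∨ (G.sub B).pair x = x := sub_pair_eq_or G B
  have hp : ∀ x, (((G.delete h hh).sub A).pair x).1 = (G.sub B).pair x.1 :=
    sub_liftEdges_pair (K := G.delete h hh) (fun _ => rfl) A
  have hflag : ∀ x, G.OnEdge h x → ¬ (G.sub B).IsFlag x := fun x => not_isFlag_of_onEdge hon hh
  have hsub : (G.delete h hh).addVertex.sub A = ((G.delete h hh).sub A).addVertex := rfl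
  -- The extra disc adds one vertex, one component and one closed face; the last compensates the
  -- inner face lost by the deletion.
  have hV : (G.delete h hh).addVertex.numVertices = G.numVertices + 1 := by
    rw [numVertices_addVertex,
      numVertices_splice (L := G.delete h hh) (P := pairsCrosses_flip hh) rfl rfl,
      numVertices_eq, spliceStep_flip]
  have hkG : (G.delete h hh).addVertex.numComponents = G.numComponents + 1 := by
    rw [numComponents_addVertex, numComponents_delete, numComponents_cut_of_isLoop hh hl]
  have hk : ((G.delete h hh).addVertex.sub A).numComponents = (G.sub B).numComponents + 1 := by
    rw [hsub, numComponents_addVertex,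
      numComponents_splice (L := (G.delete h hh).sub A) (K := G.sub B) (P := pairsCrosses_flip hh)
      rfl rfl hp, numComponents_eq,
      classCount_componentStep_of_isLoop harc hon hor hl]
    rfl
  have hF' : ((G.delete h hh).sub A).numClosedFaces + 1 = (G.sub B).numClosedFaces := by
    rw [numClosedFaces_splice (L := (G.delete h hh).sub A) (K := G.sub B) (P := pairsCrosses_flip hh)
      rfl rfl hp hflag, numClosedFaces_eq,
      freeCount_boundaryStep_of_hasInnerFace harc hon hor hh hi (fun x => hflag x.1),
      add_right_comm]
    rfl
  have hF : ((G.delete h hh).addVertex.sub A).numClosedFaces = (G.sub B).numClosedFaces := by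
    rw [hsub, numClosedFaces_addVertex, hF']
  have hC : ((G.delete h hh).addVertex.sub A).numBoundaryComponents =
      (G.sub B).numBoundaryComponents := by
    have h0 : ((G.delete h hh).addVertex.sub A).numBoundaryComponents =
      ((G.delete h hh).sub A).numBoundaryComponents := rfl
    have h1 := numBoundaryComponents_splice (P := pairsCrosses_flip hh)
      (L := (G.delete h hh).sub A) rfl rfl hp
    have h2 := numBoundaryComponents_add_numClosedFaces (G.sub B)
    -- With no points excluded, the same comparison counts all classes. The total and the closed
    -- faces both change by one, so `C_∂` is unaffected.
    rw [← freeCount_false, freeCount_boundaryStep_of_hasInnerFace harc hon hor hh hi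
      (p := fun _ => False) (by simp),
      freeCount_false] at h2
    have h3 : (G.sub B).isolated = G.isolated := rfl
    omega
  have hf : ((G.delete h hh).addVertex.sub A).numFlags = (G.sub B).numFlags :=
    numFlags_rest hp hflag
  have hnn := numVertices_le_card_add (G.delete h hh).addVertex hA
  have hn : (G.sub B).nullity = 1 + ((G.delete h hh).addVertex.sub A).nullity := by
    rw [nullity_sub hBe, nullity_sub hA]
    omega
  have e1 : (G.sub B).numVertices = G.numVertices := rfl
  have e2 : ((G.delete h hh).addVertex.sub A).numVertices =
    (G.delete h hh).addVertex.numVertices := rfl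
  rw [brTerm_eq G (G.delete h hh).addVertex B A 0 1 0 ?_ hn ?_ hC.symm hf.symm]
  · simp
  · unfold rank
    omega
  · rw [hn, hk, hF]
    push_cast
    ring

theorem not_isLoop_of_isBridge (hh : G.pair h ≠ h) (hb : G.IsBridge h hh) : ¬ G.IsLoop h := by
  intro hl
  rw [IsBridge, numComponents_delete, numComponents_cut_of_isLoop hh hl] at hb
  exact lt_irrefl _ hb

end RibbonGraph

open RibbonGraph

theorem mainTheorem3 {H : Type*} [Fintype H] [DecidableEq H] (G : RibbonGraph H)
    (h : H) (hh : G.pair h ≠ h) :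
    (G.IsRegular h hh →
      G.brPoly = (G.cut h).brPoly + (G.contract h hh).brPoly) ∧
    (G.IsBridge h hh →
      G.brPoly = LaurentPolynomial.C (MvPolynomial.X 0 - 1) * (G.cut h).brPoly + (G.contract h hh).brPoly) ∧
    (G.IsTrivialLoop h → G.IsTwistedLoop h →
      G.brPoly = (G.cut h).brPoly
        + LaurentPolynomial.C (MvPolynomial.X 1 - 1) * LaurentPolynomial.T 1 * (G.delete h hh).brPoly) ∧
    (G.IsTrivialLoop h → G.IsUntwistedLoop h → G.HasInnerFace h →
      G.brPoly = (G.cut h).brPoly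
        + LaurentPolynomial.C (MvPolynomial.X 1 - 1) * (G.delete h hh).addVertex.brPoly) ∧
    (G.IsTrivialLoop h → G.IsUntwistedLoop h →
      G.brPoly = (G.cut h).brPoly
        + LaurentPolynomial.C (MvPolynomial.X 1 - 1) * (G.contract h hh).brPoly) := by
  refine ⟨fun hr => ?_, fun hb => ?_, fun ht htw => ?_, fun ht hu hi => ?_, fun ht hu => ?_⟩
  · have hk : (G.cut h).numComponents = G.numComponents := by
      refine le_antisymm ?_ (numComponents_le_cut G h)
      rw [← numComponents_delete G h hh]
      exact not_lt.1 hr.2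
    have := brPoly_eq_add hh (K := G.contract h hh) (fun _ => rfl)
      (fun B hB => brTerm_cut_of_eq hk hB) (fun A hA => brTerm_insert_of_not_isLoop hh hr.1 hA)
    rwa [one_mul, one_mul] at this
  · have hk : (G.cut h).numComponents = G.numComponents + 1 := by
      -- A bridge raises the number of components by definition, and cutting a single edge raises it
      -- by at most one.
      refine le_antisymm (numComponents_cut_le G h) ?_
      rw [← numComponents_delete G h hh]
      exact hb
    have := brPoly_eq_add hh (K := G.contract h hh) (fun _ => rfl)
      (fun B hB => brTerm_cut_of_isBridge hk hB)
      (fun A hA => brTerm_insert_of_not_isLoop hh (not_isLoop_of_isBridge hh hb) hA)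
    rwa [one_mul] at this
  · have := brPoly_eq_add hh (K := G.delete h hh) (fun _ => rfl)
      (fun B hB => brTerm_cut_of_eq (numComponents_cut_of_isLoop hh ht.1) hB)
      (fun A hA => brTerm_insert_of_twisted hh ht.2 htw hA)
    rwa [one_mul] at this
  -- The terms are compared directly, without identifying `(G - e) ⊔ {v₀}` with `G / e`.
  · have := brPoly_eq_add hh (K := (G.delete h hh).addVertex) (fun _ => rfl)
      (fun B hB => brTerm_cut_of_eq (numComponents_cut_of_isLoop hh ht.1) hB)
      (fun A hA => brTerm_insert_of_hasInnerFace hh ht.1 hi hA)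
    rwa [one_mul] at this
  · have := brPoly_eq_add hh (K := G.contract h hh) (fun _ => rfl)
      (fun B hB => brTerm_cut_of_eq (numComponents_cut_of_isLoop hh ht.1) hB)
      (fun A hA => brTerm_insert_of_untwisted hh ht.2 hu hA)
    rwa [one_mul] at this
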